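/- **Theorem 2.2 (negative fields).** Let $q\ge 4$ be an integer. For $\beta\in\mathbb R$ and $h<0$ consider the mean-field Potts free energy $$\Phi^{(q)}_{\beta,h}(x_1,\dots,x_q)=\sum_{k=1}^q\Bigl(-\frac{\beta}{2}x_k^2+x_k\log x_k\Bigr)-h\,x_1$$ (with $0\log 0=0$) on the set of probability vectors $(x_1,\dots,x_q)$, $x_k\ge 0$, $x_1+\dots+x_q=1$. "Global minimum" means a global minimizer of $\Phi^{(q)}_{\beta,h}$ over this set, and $\beta_{\rm MF}^{(p)}=2\,\frac{p-1}{p-2}\log(p-1)$ for $p\ge 3$. (1) For all $\beta\in\mathbb R$ and $h<0$, every global minimum is a permutation in the last $q-1$ coordinates of a vector with $x_1<x_2=\dots=x_{q-1}\le x_q$. Moreover, there is a function $\beta_-^{(q)}\colon(-\infty,0)\to(0,\infty)$ such that, for all $h<0$: (2) If $\beta<\beta_-^{(q)}(h)$, there is a unique global minimum, and it satisfies $x_2=\dots=x_q$. Moreover, if $x_1=\frac1q-m$ and $x_k=\frac1q+\frac m{q-1}$ for $k=2,\dots,q$, where $\theta=\frac{q}{q-1}m\in[0,\frac1{q-1}]$,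 then $(x_1,\dots,x_q)$ is the global minimum if and only if $$\theta=\frac{e^{\beta\theta-h}-1}{(q-1)e^{\beta\theta-h}+1}.\qquad(*)$$ For every $\beta\in\mathbb R$ there is exactly one $\theta\in[0,\frac1{q-1}]$ for which $(*)$ holds. (3) If $\beta>\beta_-^{(q)}(h)$, there are exactly $q-1$ global minima, and they are the permutations in the last $q-1$ coordinates of a single vector with $x_1<x_2=\dots=x_{q-1}<x_q$. (4) If $\beta=\beta_-^{(q)}(h)$, there are exactly $q$ global minima: one is the symmetric vector $x_1=\frac1q-m$, $x_2=\dots=x_q=\frac1q+\frac m{q-1}$ for which $\theta=\frac q{q-1}m\in[0,\frac1{q-1}]$ solves $(*)$; the other $q-1$ are the permutations in the last $q-1$ coordinates of a single vector with $x_1<x_2=\dots=x_{q-1}<x_q$. (5) The function $h\mapsto\beta_-^{(q)}(h)$ is strictly increasing and continuous on $(-\infty,0)$, with $$\lim_{h\to-\infty}\beta_-^{(q)}(h)=\beta_{\rm MF}^{(q-1)}\quad\text{and}\quad\lim_{h\uparrow0}\beta_-^{(q)}(h)=\beta_{\rm MF}^{(q)}.$$ -/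

import Mathlib

open Filter Topology

noncomputable section

/-- The mean-field free energy of the `q`-state Potts model at inverse temperature `β` and
external field `h` acting on the first state, as a function of the barycentric coordinates
`(x 0, …, x (q - 1))` of the magnetization. (`Real.log 0 = 0`, so `0 log 0 = 0` as usual.) -/
def pottsFreeEnergy (q : ℕ) [NeZero q] (β h : ℝ) (x : Fin q → ℝ) : ℝ :=
  (∑ k, (-(β / 2) * x k ^ 2 + x k * Real.log (x k))) - h * x 0

/-- The set of global minima of the mean-field free energy over all probability vectors. -/
def globalMinima (q : ℕ) [NeZero q] (β h : ℝ) : Set (Fin q → ℝ) :=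
  {x | x ∈ stdSimplex ℝ (Fin q) ∧
    ∀ y ∈ stdSimplex ℝ (Fin q), pottsFreeEnergy q β h x ≤ pottsFreeEnergy q β h y}

/-- The vector `(a, b, …, b, c)` with `q` entries (for `2 ≤ q`). -/
def blockVec (q : ℕ) (a b c : ℝ) : Fin q → ℝ := fun k =>
  if k.val = 0 then a else if k.val = q - 1 then c else b

/-- All vectors obtained from `v` by permuting the last `q - 1` coordinates. -/
def lastPerms (q : ℕ) [NeZero q] (v : Fin q → ℝ) : Set (Fin q → ℝ) :=
  {x | ∃ σ : Equiv.Perm (Fin q), σ 0 = 0 ∧ x = v ∘ σ}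

/-- The symmetric vector with scalar magnetization `m`: its first coordinate is `1/q - m`, all
others are `1/q + m/(q-1)`. -/
def symVec (q : ℕ) (m : ℝ) : Fin q → ℝ := fun k =>
  if k.val = 0 then 1 / (q : ℝ) - m else 1 / (q : ℝ) + m / ((q : ℝ) - 1)

/-- The mean-field equation for symmetric minima in terms of `θ = q m / (q - 1)`. -/
def SymEquation (q : ℕ) (β h θ : ℝ) : Prop :=
  θ = (Real.exp (β * θ - h) - 1) / (((q : ℝ) - 1) * Real.exp (β * θ - h) + 1)

/-- The transitional coupling of the zero-field mean-field `q`-state Potts model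
(meaningful for `3 ≤ q`). -/
def betaMF (q : ℕ) : ℝ :=
  2 * (((q : ℝ) - 1) / ((q : ℝ) - 2)) * Real.log ((q : ℝ) - 1)

end

/-! Write `q = n + 1` and `B = betaMF n`. Once the first coordinate `a` of a minimizer is fixed, its
tail divided by `1 - a` minimizes the zero-field `n`-state energy at coupling `β (1 - a)`
(`tail_mem_globalMinima`). Hence a minimizer with constant tail has `β (1 - a) ≤ B`, and one with
non-constant tail has `β (1 - a) ≥ B`. The zero-field transition is explicit: at `betaMF p` the
energy of a vector with one distinguished coordinate `1/2 + y` is even in `y`, so the uniform vector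
and its mirror image are both minimal.

These bounds, the monotonicity of `∑ x_k²` in `β` and Cauchy–Schwarz exclude a symmetric minimum at
any coupling above one with an asymmetric minimum (`not_symmetric_of_asymmetric_of_lt`). The
symmetric and asymmetric phases are therefore separated by a single coupling, the supremum of the
symmetric one.

Second order conditions allow at most one larger coordinate in the tail. Rescaled by `β`, an
asymmetric minimum consists of `b < 1 < c` with `log b - b = log c - c = l` and `u < b` at level `l
+ h`. Its total mass is a function of `l` whose derivative is nonpositive by the second order
condition and crosses zero only upwards; so the mass determines `l` (`asymmetric_solution_unique`).
The crossing estimate rests on a Padé bound for the logarithm. A symmetric minimum is unique because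
a convex function vanishing at `0` meets an affine function with positive intercept at most once.

The same estimates keep the asymmetry of a minimizer bounded below, so both phases are closed. This
gives coexistence at the transition, continuity, and the limit at `h = 0`. Strict monotonicity in
`h` holds because the first coordinate of a minimizer strictly increases with `h`; the limit at `-∞`
follows from `B ≤ β ≤ B / (1 - exp h)` on the transition line. -/

/-! ### Continuity, compactness and closedness of the set of minima. -/

theorem continuous_pottsFreeEnergy (q : ℕ) [NeZero q] :
    Continuous fun p : (ℝ × ℝ) × (Fin q → ℝ) => pottsFreeEnergy q p.1.1 p.1.2 p.2 := by
  unfold pottsFreeEnergy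
  have h (k : Fin q) : Continuous fun p : (ℝ × ℝ) × (Fin q → ℝ) =>
      p.2 k * Real.log (p.2 k) :=
    Real.continuous_mul_log.comp (by fun_prop)
  fun_prop

theorem continuous_pottsFreeEnergy_right (q : ℕ) [NeZero q] (β h : ℝ) :
    Continuous (pottsFreeEnergy q β h) :=
  (continuous_pottsFreeEnergy q).comp (by fun_prop : Continuous fun x => (((β, h) : ℝ × ℝ), x))

theorem globalMinima_nonempty (q : ℕ) [NeZero q] (β h : ℝ) : (globalMinima q β h).Nonempty := by
  obtain ⟨x, hx, hmin⟩ := (isCompact_stdSimplex ℝ (Fin q)).exists_isMinOn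
    ⟨_, single_mem_stdSimplex ℝ (0 : Fin q)⟩ (continuous_pottsFreeEnergy_right q β h).continuousOn
  exact ⟨x, hx, fun y hy => hmin hy⟩

theorem isClosed_setOf_mem_globalMinima (q : ℕ) [NeZero q] :
    IsClosed {p : (ℝ × ℝ) × (Fin q → ℝ) | p.2 ∈ globalMinima q p.1.1 p.1.2} := by
  have hS : {p : (ℝ × ℝ) × (Fin q → ℝ) | p.2 ∈ globalMinima q p.1.1 p.1.2} =
      (Prod.snd ⁻¹' stdSimplex ℝ (Fin q)) ∩ ⋂ y ∈ stdSimplex ℝ (Fin q),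
        {p | pottsFreeEnergy q p.1.1 p.1.2 p.2 ≤ pottsFreeEnergy q p.1.1 p.1.2 y} := by
    ext p
    simp [globalMinima]
  rw [hS]
  refine ((isClosed_stdSimplex ℝ (Fin q)).preimage continuous_snd).inter
    (isClosed_biInter fun y _ => isClosed_le (continuous_pottsFreeEnergy q) ?_)
  exact (continuous_pottsFreeEnergy q).comp
    (by fun_prop : Continuous fun p : (ℝ × ℝ) × (Fin q → ℝ) => (p.1, y))

/-- The parameters at which some global minimum lies in a closed set form a closed set. -/
theorem isClosed_setOf_exists_globalMinima (q : ℕ) [NeZero q]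
    {C : Set ((ℝ × ℝ) × (Fin q → ℝ))} (hC : IsClosed C) :
    IsClosed {p : ℝ × ℝ | ∃ x ∈ globalMinima q p.1 p.2, (p, x) ∈ C} := by
  have hK := isCompact_stdSimplex ℝ (Fin q)
  have := isCompact_iff_compactSpace.mp hK
  have hm := isClosedMap_fst_of_compactSpace (X := ℝ × ℝ) (Y := stdSimplex ℝ (Fin q))
  have hcl : IsClosed ((fun p : (ℝ × ℝ) × stdSimplex ℝ (Fin q) => (p.1, (p.2 : Fin q → ℝ))) ⁻¹'
      ({p | p.2 ∈ globalMinima q p.1.1 p.1.2} ∩ C)) :=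
    ((isClosed_setOf_mem_globalMinima q).inter hC).preimage (by fun_prop)
  convert hm _ hcl using 1
  ext p
  constructor
  · rintro ⟨x, hx, hxC⟩
    exact ⟨(p, ⟨x, hx.1⟩), ⟨hx, hxC⟩, rfl⟩
  · rintro ⟨⟨p', x⟩, ⟨h1, h2⟩, rfl⟩
    exact ⟨x, h1, h2⟩

/-! ### Transfer of mass and positivity of minimizers. -/

/-- Moving mass between two coordinates. -/
theorem pottsFreeEnergy_update_update {q : ℕ} [NeZero q] (β h : ℝ) (x : Fin q → ℝ) {i j : Fin q}
    (hij : i ≠ j) (s t : ℝ) :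
    pottsFreeEnergy q β h (Function.update (Function.update x i s) j t) =
      pottsFreeEnergy q β h x
        + (-(β / 2) * s ^ 2 + s * Real.log s - (-(β / 2) * x i ^ 2 + x i * Real.log (x i)))
        + (-(β / 2) * t ^ 2 + t * Real.log t - (-(β / 2) * x j ^ 2 + x j * Real.log (x j)))
        - h * (if i = 0 then s - x i else 0) - h * (if j = 0 then t - x j else 0) := by
  have key : ∀ k, (-(β / 2) * Function.update (Function.update x i s) j t k ^ 2 +
      Function.update (Function.update x i s) j t k *
        Real.log (Function.update (Function.update x i s) j t k)) =
      (-(β / 2) * x k ^ 2 + x k * Real.log (x k)) +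
      (if k = i then (-(β / 2) * s ^ 2 + s * Real.log s -
        (-(β / 2) * x i ^ 2 + x i * Real.log (x i))) else 0) +
      (if k = j then (-(β / 2) * t ^ 2 + t * Real.log t -
        (-(β / 2) * x j ^ 2 + x j * Real.log (x j))) else 0) := by
    intro k
    rcases eq_or_ne k j with rfl | hkj
    · simp [hij.symm]
    · rcases eq_or_ne k i with rfl | hki
      · simp [hij]
      · simp [hki, hkj]
  have h0 : Function.update (Function.update x i s) j t 0 =
      x 0 + (if i = 0 then s - x i else 0) + (if j = 0 then t - x j else 0) := by
    rcases eq_or_ne 0 j with rfl | hkj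
    · simp [hij]
    · rcases eq_or_ne 0 i with rfl | hki
      · simp [hij, hij.symm]
      · simp [hki, hkj, hki.symm, hkj.symm]
  unfold pottsFreeEnergy
  rw [Finset.sum_congr rfl fun k _ => key k, h0, Finset.sum_add_distrib, Finset.sum_add_distrib]
  simp only [Finset.sum_ite_eq', Finset.mem_univ, if_true]
  ring

theorem update_update_mem_stdSimplex {q : ℕ} {x : Fin q → ℝ} (hx : x ∈ stdSimplex ℝ (Fin q))
    {i j : Fin q} (hij : i ≠ j) {s t : ℝ} (hs : 0 ≤ s) (ht : 0 ≤ t) (hst : s + t = x i + x j) :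
    Function.update (Function.update x i s) j t ∈ stdSimplex ℝ (Fin q) := by
  refine ⟨fun k => ?_, ?_⟩
  · rcases eq_or_ne k j with rfl | hkj
    · simpa
    · rcases eq_or_ne k i with rfl | hki
      · simpa [hij]
      · simpa [hki, hkj] using hx.1 k
  · have key : ∀ k, Function.update (Function.update x i s) j t k =
        x k + (if k = i then s - x i else 0) + (if k = j then t - x j else 0) := by
      intro k
      rcases eq_or_ne k j with rfl | hkj
      · simp [hij.symm]
      · rcases eq_or_ne k i with rfl | hki
        · simp [hij]
        · simp [hki, hkj]
    rw [Finset.sum_congr rfl fun k _ => key k, Finset.sum_add_distrib, Finset.sum_add_distrib,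
      hx.2]
    simp only [Finset.sum_ite_eq', Finset.mem_univ, if_true]
    linarith

/-- The infinite slope of `t log t` at `0` beats a linear term. -/
theorem exists_mul_log_lt {S C : ℝ} (hS : 0 < S) :
    ∃ t, 0 < t ∧ t < S ∧ t * Real.log t + (S - t) * Real.log (S - t) + C * t < S * Real.log S := by
  -- With `t < E` and `t < S / 2`, `log t` is below `log (S - t) - C`, since `log (S - t) ≥ log (S /
  -- 2)`.
  set E := Real.exp (-(|C| + |Real.log (S / 2)| + 1)) with hE
  set t := min (S / 2) E / 2
  have hEp : 0 < E := Real.exp_pos _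
  have ht : 0 < t := by positivity
  have ht1 : t < S / 2 := by
    have := min_le_left (S / 2) E
    simp only [t]; linarith
  have ht2 : t < E := by
    have := min_le_right (S / 2) E
    simp only [t]; linarith
  refine ⟨t, ht, by linarith, ?_⟩
  have hl : Real.log t < -(|C| + |Real.log (S / 2)| + 1) := by
    rw [Real.log_lt_iff_lt_exp ht]; exact ht2
  have hSt : 0 < S - t := by linarith
  have h1 : (S - t) * Real.log (S - t) + t * Real.log (S - t) ≤ S * Real.log S := by
    have : Real.log (S - t) ≤ Real.log S := Real.log_le_log hSt (by linarith)
    nlinarith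
  have h2 : Real.log (S / 2) ≤ Real.log (S - t) := Real.log_le_log (by linarith) (by linarith)
  have h3 : -|Real.log (S / 2)| ≤ Real.log (S / 2) := neg_abs_le _
  have h4 : C ≤ |C| := le_abs_self _
  nlinarith

/-- Moving mass `t` from an occupied coordinate to an empty one changes the quadratic and field
terms by `O(t)`, while the entropy term gains `t log t`. -/
theorem globalMinima_pos {q : ℕ} [NeZero q] {β h : ℝ} {x : Fin q → ℝ}
    (hx : x ∈ globalMinima q β h) (i : Fin q) : 0 < x i := by
  by_contra hi
  have hi0 : x i = 0 := le_antisymm (not_lt.mp hi) (hx.1.1 i)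
  obtain ⟨j, hj⟩ : ∃ j, 0 < x j := by
    by_contra! hcon
    have := Finset.sum_nonpos fun k (_ : k ∈ Finset.univ) => hcon k
    rw [hx.1.2] at this
    linarith
  have hij : i ≠ j := by rintro rfl; exact hi hj
  obtain ⟨t, ht, htS, hlt⟩ := exists_mul_log_lt (S := x j) (C := |β| * x j + |h|) hj
  have hmin := hx.2 _ (update_update_mem_stdSimplex hx.1 hij ht.le
    (by linarith : 0 ≤ x j - t) (by rw [hi0]; ring))
  rw [pottsFreeEnergy_update_update β h x hij, hi0] at hmin
  have hb : -(β / 2) * t ^ 2 + -(β / 2) * (x j - t) ^ 2 - -(β / 2) * x j ^ 2 ≤ |β| * x j * t := by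
    have h1 : -(β / 2) * t ^ 2 + -(β / 2) * (x j - t) ^ 2 - -(β / 2) * x j ^ 2 =
      β * (t * (x j - t)) := by ring
    have h2 : β * (t * (x j - t)) ≤ |β| * (t * (x j - t)) :=
      mul_le_mul_of_nonneg_right (le_abs_self _) (mul_nonneg ht.le (by linarith))
    have h3 : |β| * (t * (x j - t)) ≤ |β| * (t * x j) :=
      mul_le_mul_of_nonneg_left (by nlinarith) (abs_nonneg _)
    linarith
  have hh : -(h * (if i = 0 then t - 0 else 0)) - h * (if j = 0 then x j - t - x j else 0)
      ≤ |h| * t := by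
    have e1 := mul_le_mul_of_nonneg_right (le_abs_self h) ht.le
    have e2 := mul_le_mul_of_nonneg_right (neg_abs_le h) ht.le
    have e3 := mul_nonneg (abs_nonneg h) ht.le
    rcases eq_or_ne i 0 with rfl | h1
    · simp [hij.symm]; linarith
    · rcases eq_or_ne j 0 with rfl | h2
      · simp [h1]; linarith
      · simp [h1, h2]; linarith
  simp only [zero_mul, mul_zero, ne_eq, OfNat.ofNat_ne_zero, not_false_eq_true, zero_pow] at hmin hh
  linarith

/-! ### First and second order conditions. -/

/-- If `g'' < 0`, the second derivative test makes `0` a local maximum as well, so `g` is locally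
constant and `g'' = 0`. -/
theorem IsLocalMin.second_deriv_nonneg {g g' : ℝ → ℝ} {g'' : ℝ} (hmin : IsLocalMin g 0)
    (hg : ∀ᶠ t in 𝓝 0, HasDerivAt g (g' t) t) (hg' : HasDerivAt g' g'' 0) : 0 ≤ g'' := by
  by_contra hneg
  push Not at hneg
  have hd : deriv g =ᶠ[𝓝 0] g' := hg.mono fun t ht => ht.deriv
  have h0 : deriv g 0 = 0 := hmin.deriv_eq_zero
  have hdd : deriv (deriv g) 0 = g'' := by rw [hd.deriv_eq, hg'.deriv]
  have hmax := isLocalMax_of_deriv_deriv_neg (hdd ▸ hneg) h0 hg.self_of_nhds.continuousAt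
  have hconst : g =ᶠ[𝓝 0] fun _ => g 0 := by
    filter_upwards [hmin, hmax] with t h1 h2 using le_antisymm h2 h1
  have hd0 : deriv g =ᶠ[𝓝 0] fun _ => 0 := by
    have := hconst.eventually_nhds
    filter_upwards [this] with t ht
    rw [Filter.EventuallyEq.deriv_eq ht, deriv_const]
  have : deriv (deriv g) 0 = 0 := by rw [hd0.deriv_eq, deriv_const]
  linarith

/-- First and second order conditions at a global minimum, in directions of zero total mass. -/
theorem globalMinima_order_conditions {q : ℕ} [NeZero q] {β h : ℝ} {x : Fin q → ℝ}
    (hx : x ∈ globalMinima q β h) {v : Fin q → ℝ} (hv : ∑ k, v k = 0) :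
    ∑ k, v k * (Real.log (x k) - β * x k) = h * v 0 ∧
      0 ≤ ∑ k, v k ^ 2 * ((x k)⁻¹ - β) := by
  have hpos := globalMinima_pos hx
  set g : ℝ → ℝ := fun t => pottsFreeEnergy q β h fun k => x k + t * v k with hg
  set g' : ℝ → ℝ := fun t =>
    (∑ k, v k * (-(β * (x k + t * v k)) + Real.log (x k + t * v k) + 1)) - h * v 0
  have hev : ∀ᶠ t in 𝓝 (0 : ℝ), ∀ k, 0 < x k + t * v k := by
    rw [eventually_all]
    intro k
    have : Tendsto (fun t : ℝ => x k + t * v k) (𝓝 0) (𝓝 (x k + 0 * v k)) :=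
      Continuous.tendsto (by fun_prop) 0
    rw [zero_mul, add_zero] at this
    exact this.eventually_const_lt (hpos k)
  have hmin : IsLocalMin g 0 := by
    filter_upwards [hev] with t ht
    simp only [hg, zero_mul, add_zero]
    refine hx.2 _ ⟨fun k => (ht k).le, ?_⟩
    rw [Finset.sum_add_distrib, ← Finset.mul_sum, hv, hx.1.2]
    ring
  have hder : ∀ᶠ t in 𝓝 (0 : ℝ), HasDerivAt g (g' t) t := by
    filter_upwards [hev] with t ht
    simp only [hg, g', pottsFreeEnergy]
    refine HasDerivAt.sub (HasDerivAt.fun_sum fun k _ => ?_) ?_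
    · have hl : HasDerivAt (fun t : ℝ => x k + t * v k) (v k) t := by
        simpa using ((hasDerivAt_id t).mul_const (v k)).const_add (x k)
      have h2 := ((hl.pow 2).const_mul (-(β / 2))).add (hl.mul (hl.log (ht k).ne'))
      have := (ht k).ne'
      refine h2.congr_deriv ?_
      field_simp
      push_cast
      ring
    · have hl : HasDerivAt (fun t : ℝ => x 0 + t * v 0) (v 0) t := by
        simpa using ((hasDerivAt_id t).mul_const (v 0)).const_add (x 0)
      exact hl.const_mul h
  have hder' : HasDerivAt g' (∑ k, v k ^ 2 * ((x k)⁻¹ - β)) 0 := by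
    have : HasDerivAt g' ((∑ k, v k ^ 2 * ((x k)⁻¹ - β)) - 0) 0 := by
      refine HasDerivAt.sub (HasDerivAt.fun_sum fun k _ => ?_) (hasDerivAt_const _ _)
      have hl : HasDerivAt (fun t : ℝ => x k + t * v k) (v k) 0 := by
        simpa using ((hasDerivAt_id (0 : ℝ)).mul_const (v k)).const_add (x k)
      have hne : x k + 0 * v k ≠ 0 := by simpa using (hpos k).ne'
      have h2 := ((((hl.const_mul β).neg).add (hl.log hne)).add_const 1).const_mul (v k)
      refine h2.congr_deriv ?_
      rw [zero_mul, add_zero]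
      ring
    simpa using this
  refine ⟨?_, hmin.second_deriv_nonneg hder hder'⟩
  have h0 := hmin.hasDerivAt_eq_zero hder.self_of_nhds
  simp only [g', zero_mul, add_zero] at h0
  have : ∑ k, v k * (-(β * x k) + Real.log (x k) + 1) =
      ∑ k, v k * (Real.log (x k) - β * x k) + ∑ k, v k := by
    rw [← Finset.sum_add_distrib]
    exact Finset.sum_congr rfl fun k _ => by ring
  rw [this, hv] at h0
  linarith

theorem globalMinima_first_order {q : ℕ} [NeZero q] {β h : ℝ} {x : Fin q → ℝ}
    (hx : x ∈ globalMinima q β h) (j k : Fin q) :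
    (Real.log (x j) - β * x j) - (Real.log (x k) - β * x k) =
      h * ((Pi.single j 1 : Fin q → ℝ) 0 - (Pi.single k 1 : Fin q → ℝ) 0) := by
  have := (globalMinima_order_conditions hx (v := Pi.single j 1 - Pi.single k 1)
    (by simp)).1
  rw [Pi.sub_apply] at this
  rw [← this]
  simp [sub_mul, Finset.sum_sub_distrib, Pi.single_apply]

/-- The alternatives `h = 0` let one statement serve both the tail in a field and all coordinates of
the zero-field model. -/
theorem globalMinima_log_eq {q : ℕ} [NeZero q] {β h : ℝ} {x : Fin q → ℝ}
    (hx : x ∈ globalMinima q β h) {j k : Fin q} (hj : j ≠ 0 ∨ h = 0) (hk : k ≠ 0 ∨ h = 0) :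
    Real.log (x j) - β * x j = Real.log (x k) - β * x k := by
  have := globalMinima_first_order hx j k
  rcases hj with hj | rfl
  · rcases hk with hk | rfl
    · simp [hj.symm, hk.symm] at this
      linarith
    · linarith
  · linarith

theorem globalMinima_log_eq_field {q : ℕ} [NeZero q] {β h : ℝ} {x : Fin q → ℝ}
    (hx : x ∈ globalMinima q β h) {k : Fin q} (hk : k ≠ 0) :
    Real.log (x 0) - β * x 0 = Real.log (x k) - β * x k + h := by
  have := globalMinima_first_order hx 0 k
  simp [hk.symm] at this
  linarith

theorem globalMinima_second_order_pair {q : ℕ} [NeZero q] {β h : ℝ} {x : Fin q → ℝ}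
    (hx : x ∈ globalMinima q β h) {j k : Fin q} (hjk : j ≠ k) :
    0 ≤ ((x j)⁻¹ - β) + ((x k)⁻¹ - β) := by
  have := (globalMinima_order_conditions hx (v := Pi.single j 1 - Pi.single k 1)
    (by simp)).2
  refine this.trans_eq ?_
  have key : ∀ l, (Pi.single j 1 - Pi.single k 1 : Fin q → ℝ) l ^ 2 * ((x l)⁻¹ - β) =
      (if l = j then ((x j)⁻¹ - β) else 0) + if l = k then ((x k)⁻¹ - β) else 0 := by
    intro l
    rcases eq_or_ne l j with rfl | h1
    · simp [hjk]
    · rcases eq_or_ne l k with rfl | h2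
      · simp [h1]
      · simp [h1, h2]
  rw [Finset.sum_congr rfl fun l _ => key l, Finset.sum_add_distrib]
  simp

/-! ### Ordering and shape of minimizers. -/

/-- Exchanging coordinates `0` and `k` changes the energy only through the field term. -/
theorem globalMinima_zero_le {q : ℕ} [NeZero q] {β h : ℝ} (hh : h < 0) {x : Fin q → ℝ}
    (hx : x ∈ globalMinima q β h) (k : Fin q) : x 0 ≤ x k := by
  rcases eq_or_ne k 0 with rfl | hk
  · rfl
  have := hx.2 _ (update_update_mem_stdSimplex hx.1 hk.symm (hx.1.1 k) (hx.1.1 0) (add_comm _ _))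
  rw [pottsFreeEnergy_update_update β h x hk.symm] at this
  simp only [if_true, hk, if_false] at this
  nlinarith

theorem globalMinima_zero_lt {q : ℕ} [NeZero q] {β h : ℝ} (hh : h < 0) {x : Fin q → ℝ}
    (hx : x ∈ globalMinima q β h) {k : Fin q} (hk : k ≠ 0) : x 0 < x k := by
  refine lt_of_le_of_ne (globalMinima_zero_le hh hx k) fun heq => ?_
  have := globalMinima_log_eq_field hx hk
  rw [heq] at this
  linarith

/-- Two points with the same value of `log t - β t` lie on different sides of `1 / β`. -/
theorem mul_lt_one_lt_mul_of_log_eq {β a b : ℝ} (ha : 0 < a) (hab : a < b)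
    (h : Real.log a - β * a = Real.log b - β * b) : β * a < 1 ∧ 1 < β * b := by
  have hb := ha.trans hab
  -- The bound `log r < r - 1` at `r = b / a` and `r = a / b` places the chord slope `β` of `log`
  -- strictly between `1 / b` and `1 / a`.
  have h1 := Real.log_lt_sub_one_of_pos (div_pos hb ha) (by rw [ne_eq, div_eq_one_iff_eq ha.ne']; exact hab.ne')
  have h2 := Real.log_lt_sub_one_of_pos (div_pos ha hb) (by rw [ne_eq, div_eq_one_iff_eq hb.ne']; exact hab.ne)
  rw [Real.log_div hb.ne' ha.ne'] at h1
  rw [Real.log_div ha.ne' hb.ne'] at h2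
  constructor
  · have e : b / a - 1 = (b - a) * a⁻¹ := by field_simp
    have : β * (b - a) < (b - a) * a⁻¹ := by rw [← e]; linarith
    have : β < a⁻¹ := by
      by_contra hcon; push Not at hcon
      nlinarith
    rwa [← lt_div_iff₀ ha, one_div]
  · have e : a / b - 1 = -((b - a) * b⁻¹) := by field_simp; ring
    have : (b - a) * b⁻¹ < β * (b - a) := by linarith
    have : b⁻¹ < β := by
      by_contra hcon; push Not at hcon
      nlinarith
    rwa [← div_lt_iff₀ hb, one_div]

theorem eq_of_log_eq_of_mul_le_one {β a b : ℝ} (ha : 0 < a) (hb : 0 < b)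
    (h : Real.log a - β * a = Real.log b - β * b) (h1 : β * a ≤ 1) (h2 : β * b ≤ 1) : a = b := by
  rcases lt_trichotomy a b with hlt | heq | hlt
  · linarith [(mul_lt_one_lt_mul_of_log_eq ha hlt h).2]
  · exact heq
  · linarith [(mul_lt_one_lt_mul_of_log_eq hb hlt h.symm).2]

/-- Among the coordinates without field, at most one differs from the others, and it is larger. -/
theorem globalMinima_structure {q : ℕ} [NeZero q] {β h : ℝ} {x : Fin q → ℝ}
    (hx : x ∈ globalMinima q β h) {F : Set (Fin q)} (hF : ∀ j ∈ F, j ≠ 0 ∨ h = 0) :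
    (∀ j ∈ F, ∀ k ∈ F, x j = x k) ∨
      ∃ k ∈ F, ∃ j ∈ F, x j < x k ∧ β * x j < 1 ∧ 1 < β * x k ∧
        ∀ l ∈ F, l ≠ k → x l = x j := by
  have hpos := globalMinima_pos hx
  by_cases hall : ∀ j ∈ F, ∀ k ∈ F, x j ≤ x k
  · exact Or.inl fun j hj k hk => le_antisymm (hall j hj k hk) (hall k hk j hj)
  right
  push Not at hall
  obtain ⟨k, hk, j, hj, hlt⟩ := hall
  have hl := globalMinima_log_eq hx (hF j hj) (hF k hk)
  obtain ⟨h1, h2⟩ := mul_lt_one_lt_mul_of_log_eq (hpos j) hlt hl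
  refine ⟨k, hk, j, hj, hlt, h1, h2, fun l hlF hlk => ?_⟩
  refine eq_of_log_eq_of_mul_le_one (hpos l) (hpos j)
    (globalMinima_log_eq hx (hF l hlF) (hF j hj)) ?_ h1.le
  -- Two coordinates beyond `1 / β` would give a negative second variation for mass moved between
  -- them.
  by_contra hcon
  push Not at hcon
  have e := globalMinima_second_order_pair hx hlk
  have e1 : (x l)⁻¹ < β := by rw [← one_div, div_lt_iff₀ (hpos l)]; exact hcon
  have e2 : (x k)⁻¹ < β := by rw [← one_div, div_lt_iff₀ (hpos k)]; exact h2
  linarith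

/-! ### Monotonicity in the coupling and in the field. -/

/-- The interaction energy is monotone in the coupling along global minima. -/
theorem sum_sq_le_of_globalMinima {q : ℕ} [NeZero q] {β β' h : ℝ} (hβ : β < β')
    {x y : Fin q → ℝ} (hx : x ∈ globalMinima q β h) (hy : y ∈ globalMinima q β' h) :
    ∑ k, x k ^ 2 ≤ ∑ k, y k ^ 2 := by
  have h1 := hx.2 y hy.1
  have h2 := hy.2 x hx.1
  simp only [pottsFreeEnergy, Finset.sum_add_distrib, ← Finset.mul_sum] at h1 h2
  nlinarith

/-- The field term is monotone in the field along global minima. -/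
theorem zero_le_zero_of_globalMinima {q : ℕ} [NeZero q] {β h h' : ℝ} (hh : h < h')
    {x y : Fin q → ℝ} (hx : x ∈ globalMinima q β h) (hy : y ∈ globalMinima q β h') :
    x 0 ≤ y 0 := by
  have h1 := hx.2 y hy.1
  have h2 := hy.2 x hx.1
  simp only [pottsFreeEnergy] at h1 h2
  nlinarith

theorem eq_inv_card_of_sum_sq_le {q : ℕ} [NeZero q] {x : Fin q → ℝ}
    (hx : x ∈ stdSimplex ℝ (Fin q)) (h : (q : ℝ) * ∑ k, x k ^ 2 ≤ 1) (k : Fin q) :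
    x k = (q : ℝ)⁻¹ := by
  have hq : (0 : ℝ) < q := by exact_mod_cast NeZero.pos q
  have h0 : ∑ k, (x k - (q : ℝ)⁻¹) ^ 2 = ∑ k, x k ^ 2 - (q : ℝ)⁻¹ := by
    have : ∀ k, (x k - (q : ℝ)⁻¹) ^ 2 = x k ^ 2 - 2 * (q : ℝ)⁻¹ * x k + (q : ℝ)⁻¹ ^ 2 :=
      fun k => by ring
    rw [Finset.sum_congr rfl fun k _ => this k, Finset.sum_add_distrib, Finset.sum_sub_distrib,
      ← Finset.mul_sum, hx.2]
    simp
    field_simp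
    ring
  have h1 : ∑ k, x k ^ 2 ≤ (q : ℝ)⁻¹ := by
    rw [← one_div, le_div_iff₀ hq]; linarith
  have h2 : (x k - (q : ℝ)⁻¹) ^ 2 ≤ ∑ k, (x k - (q : ℝ)⁻¹) ^ 2 :=
    Finset.single_le_sum (f := fun k => (x k - (q : ℝ)⁻¹) ^ 2) (fun i _ => sq_nonneg _)
      (Finset.mem_univ k)
  have h3 : (x k - (q : ℝ)⁻¹) ^ 2 = 0 := le_antisymm (by linarith) (sq_nonneg _)
  have := pow_eq_zero_iff (two_ne_zero) |>.mp h3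
  linarith

/-! ### The zero-field transition at `betaMF`. -/

/-- Monotonicity of `f t / t`, written without division so that `a = 0` is allowed. -/
theorem ConvexOn.mul_le_mul_of_zero {f : ℝ → ℝ} {s : Set ℝ} (hf : ConvexOn ℝ s f) (h0s : 0 ∈ s)
    (h0 : f 0 = 0) {a b : ℝ} (ha : 0 ≤ a) (hab : a ≤ b) (hb : 0 < b) (hbs : b ∈ s) :
    b * f a ≤ a * f b := by
  have h1 : a / b ≤ 1 := (div_le_one hb).mpr hab
  have := hf.2 h0s hbs (sub_nonneg.mpr h1) (by positivity : 0 ≤ a / b) (by ring)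
  simp only [smul_eq_mul, mul_zero, zero_add, h0, div_mul_cancel₀ a hb.ne'] at this
  calc b * f a ≤ b * (a / b * f b) := mul_le_mul_of_nonneg_left this hb.le
    _ = a * f b := by field_simp

theorem hasDerivAt_log_half_add_sub_log_half_sub {y : ℝ} (h1 : -(1 / 2) < y) (h2 : y < 1 / 2) :
    HasDerivAt (fun y : ℝ => Real.log (1 / 2 + y) - Real.log (1 / 2 - y))
      ((1 / 2 + y)⁻¹ + (1 / 2 - y)⁻¹) y := by
  have e1 := ((hasDerivAt_id y).const_add (1 / 2)).log (by simp; linarith)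
  have e2 := ((hasDerivAt_id y).const_sub (1 / 2)).log (by simp; linarith)
  refine (e1.sub e2).congr_deriv ?_
  simp
  ring

theorem convexOn_log_half_add_sub_log_half_sub :
    ConvexOn ℝ (Set.Ico 0 (1 / 2)) fun y : ℝ => Real.log (1 / 2 + y) - Real.log (1 / 2 - y) := by
  refine MonotoneOn.convexOn_of_deriv (convex_Ico _ _) ?_ ?_ ?_
  · intro y hy
    exact (hasDerivAt_log_half_add_sub_log_half_sub (by linarith [hy.1]) hy.2).continuousAt.continuousWithinAt
  · intro y hy
    rw [interior_Ico] at hy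
    exact (hasDerivAt_log_half_add_sub_log_half_sub (by linarith [hy.1]) hy.2).differentiableAt.differentiableWithinAt
  · intro y hy z hz hyz
    rw [interior_Ico] at hy hz
    rw [(hasDerivAt_log_half_add_sub_log_half_sub (by linarith [hy.1]) hy.2).deriv,
      (hasDerivAt_log_half_add_sub_log_half_sub (by linarith [hz.1]) hz.2).deriv]
    obtain ⟨hy1, hy2⟩ := hy
    obtain ⟨hz1, hz2⟩ := hz
    have e : ∀ t : ℝ, 0 < t → t < 1 / 2 → (1 / 2 + t)⁻¹ + (1 / 2 - t)⁻¹ = 1 / (1 / 4 - t ^ 2) := by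
      intro t h1 h2
      rw [inv_add_inv (by linarith) (by linarith)]
      congr 1 <;> ring
    rw [e y hy1 hy2, e z hz1 hz2]
    exact one_div_le_one_div_of_le (by nlinarith) (by nlinarith)

/-- The two-level energy `-κ y² + (1/2 + y) log (1/2 + y) + (1/2 - y) log (1/2 - y)` is minimal at
its positive critical point. -/
theorem two_level_energy_min {κ y₀ : ℝ} (h0 : 0 < y₀) (h1 : y₀ < 1 / 2)
    (hκ : 2 * κ * y₀ = Real.log (1 / 2 + y₀) - Real.log (1 / 2 - y₀)) {y : ℝ} (hy : |y| ≤ 1 / 2) :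
    -κ * y₀ ^ 2 + (1 / 2 + y₀) * Real.log (1 / 2 + y₀) + (1 / 2 - y₀) * Real.log (1 / 2 - y₀) ≤
      -κ * y ^ 2 + (1 / 2 + y) * Real.log (1 / 2 + y) + (1 / 2 - y) * Real.log (1 / 2 - y) := by
  set Γ : ℝ → ℝ := fun y =>
    -κ * y ^ 2 + (1 / 2 + y) * Real.log (1 / 2 + y) + (1 / 2 - y) * Real.log (1 / 2 - y) with hΓ
  change Γ y₀ ≤ Γ y
  have heven : Γ y = Γ |y| := by
    rcases abs_cases y with ⟨h, -⟩ | ⟨h, -⟩ <;> rw [h]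
    simp only [hΓ]
    ring_nf
  rw [heven]
  have hcont : Continuous Γ := by
    have c1 := Real.continuous_mul_log.comp (by fun_prop : Continuous fun y : ℝ => 1 / 2 + y)
    have c2 := Real.continuous_mul_log.comp (by fun_prop : Continuous fun y : ℝ => 1 / 2 - y)
    exact ((by fun_prop : Continuous fun y : ℝ => -κ * y ^ 2).add c1).add c2
  have hder : ∀ t, 0 < t → t < 1 / 2 →
      HasDerivAt Γ (Real.log (1 / 2 + t) - Real.log (1 / 2 - t) - 2 * κ * t) t := by
    intro t ht0 ht1
    have n1 : 1 / 2 + t ≠ 0 := by linarith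
    have n2 : 1 / 2 - t ≠ 0 := by linarith
    have d1 := (hasDerivAt_id' t).const_add (1 / 2)
    have d2 := (hasDerivAt_id' t).const_sub (1 / 2)
    have d := ((((hasDerivAt_id' t).pow 2).const_mul (-κ)).add
      (d1.mul (d1.log n1))).add (d2.mul (d2.log n2))
    have e : ∀ w : ℝ, w ≠ 0 → w * (-1 / w) = -1 := fun w hw => by field_simp
    refine d.congr_deriv ?_
    rw [mul_one_div_cancel n1, e _ n2]
    push_cast
    ring
  -- By `hκ`, `2 κ t` is the chord of this convex function through `0` and `y₀`; it lies above the
  -- function before `y₀` and below it after, which fixes the sign of `Γ'`.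
  have hc := convexOn_log_half_add_sub_log_half_sub
  have hz : (fun y : ℝ => Real.log (1 / 2 + y) - Real.log (1 / 2 - y)) 0 = 0 := by simp
  have hmem0 : (0 : ℝ) ∈ Set.Ico (0 : ℝ) (1 / 2) := by constructor <;> norm_num
  rcases le_total |y| y₀ with hle | hle
  · have hanti : AntitoneOn Γ (Set.Icc 0 y₀) := by
      refine antitoneOn_of_deriv_nonpos (convex_Icc _ _) hcont.continuousOn ?_ ?_
      · intro t ht
        rw [interior_Icc] at ht
        exact (hder t ht.1 (ht.2.trans h1)).differentiableAt.differentiableWithinAt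
      · intro t ht
        rw [interior_Icc] at ht
        rw [(hder t ht.1 (ht.2.trans h1)).deriv]
        have := hc.mul_le_mul_of_zero hmem0 hz ht.1.le ht.2.le h0 ⟨h0.le, h1⟩
        rw [← hκ] at this
        have : y₀ * (Real.log (1 / 2 + t) - Real.log (1 / 2 - t) - 2 * κ * t) ≤ 0 := by linarith
        exact nonpos_of_mul_nonpos_right this h0
    exact hanti ⟨abs_nonneg y, hle⟩ ⟨h0.le, le_rfl⟩ hle
  · have hmono : MonotoneOn Γ (Set.Icc y₀ (1 / 2)) := by
      refine monotoneOn_of_deriv_nonneg (convex_Icc _ _) hcont.continuousOn ?_ ?_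
      · intro t ht
        rw [interior_Icc] at ht
        exact (hder t (h0.trans ht.1) ht.2).differentiableAt.differentiableWithinAt
      · intro t ht
        rw [interior_Icc] at ht
        rw [(hder t (h0.trans ht.1) ht.2).deriv]
        have ht0 := h0.trans ht.1
        have := hc.mul_le_mul_of_zero hmem0 hz h0.le ht.1.le ht0 ⟨ht0.le, ht.2⟩
        rw [← hκ] at this
        have : 0 ≤ y₀ * (Real.log (1 / 2 + t) - Real.log (1 / 2 - t) - 2 * κ * t) := by linarith
        exact nonneg_of_mul_nonneg_right this h0
    exact hmono ⟨le_rfl, h1.le⟩ ⟨hle, hy⟩ hle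

theorem sum_eq_add_of_forall_ne {p : ℕ} {f : Fin p → ℝ} {k : Fin p} {v : ℝ}
    (hf : ∀ l, l ≠ k → f l = v) : ∑ l, f l = f k + ((p : ℝ) - 1) * v := by
  rw [← Finset.add_sum_erase _ _ (Finset.mem_univ k),
    Finset.sum_congr rfl fun l hl => hf l (Finset.ne_of_mem_erase hl), Finset.sum_const,
    Finset.card_erase_of_mem (Finset.mem_univ k)]
  have : 1 ≤ p := Fin.pos k
  simp [Nat.cast_sub this]

/-- The energy at the transitional coupling of a vector with all but one coordinates equal. -/
theorem pottsFreeEnergy_betaMF_eq {p : ℕ} [NeZero p] (hp : 3 ≤ p) {z : Fin p → ℝ} {k : Fin p}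
    {b y : ℝ} (hk : z k = 1 / 2 + y) (hz : ∀ l, l ≠ k → z l = b)
    (hb : ((p : ℝ) - 1) * b = 1 / 2 - y) :
    pottsFreeEnergy p (betaMF p) 0 z =
      -((p : ℝ) / (p - 2) * Real.log (p - 1)) * y ^ 2 + (1 / 2 + y) * Real.log (1 / 2 + y)
        + (1 / 2 - y) * Real.log (1 / 2 - y)
        - (p / (p - 2) * Real.log (p - 1) / 4 + Real.log (p - 1) / 2) := by
  have hp3 : (3 : ℝ) ≤ p := by exact_mod_cast hp
  have hp1 : (p : ℝ) - 1 ≠ 0 := by linarith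
  have hp2 : (p : ℝ) - 2 ≠ 0 := by linarith
  have hbl : ((p : ℝ) - 1) * (b * Real.log b) =
      (1 / 2 - y) * (Real.log (1 / 2 - y) - Real.log (p - 1)) := by
    rw [← mul_assoc, hb]
    rcases eq_or_ne b 0 with rfl | hb0
    · rw [← hb]; simp
    · rw [← hb, Real.log_mul hp1 hb0]
      ring
  have hb' : b = (1 / 2 - y) / ((p : ℝ) - 1) := by rw [← hb]; field_simp
  unfold pottsFreeEnergy
  rw [sum_eq_add_of_forall_ne (k := k) (v := -(betaMF p / 2) * b ^ 2 + b * Real.log b)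
    fun l hl => by rw [hz l hl], hk, mul_add, hbl, hb', betaMF]
  -- The terms linear in `y` cancel: `log (p - 1)` from the entropy against `(β / 2) (p - 2) / (p -
  -- 1)` from the interaction. This is what singles out `betaMF`.
  field_simp
  ring

/-- This is the critical point equation required by `two_level_energy_min` at `y₀ = (p - 2) / (2
p)`, where `1/2 ± y₀` are `(p - 1) / p` and `1 / p`. -/
theorem log_sub_log_betaMF {p : ℕ} (hp : 3 ≤ p) :
    2 * ((p : ℝ) / (p - 2) * Real.log (p - 1)) * (((p : ℝ) - 2) / (2 * p)) =
      Real.log (1 / 2 + ((p : ℝ) - 2) / (2 * p)) - Real.log (1 / 2 - ((p : ℝ) - 2) / (2 * p)) := by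
  have hp3 : (3 : ℝ) ≤ p := by exact_mod_cast hp
  have hp1 : (p : ℝ) - 1 ≠ 0 := by linarith
  have hp2 : (p : ℝ) - 2 ≠ 0 := by linarith
  have hp0 : (p : ℝ) ≠ 0 := by linarith
  have e1 : 1 / 2 + ((p : ℝ) - 2) / (2 * p) = (p - 1) / p := by field_simp; ring
  have e2 : 1 / 2 - ((p : ℝ) - 2) / (2 * p) = 1 / p := by field_simp; ring
  rw [e1, e2, Real.log_div hp1 hp0, one_div, Real.log_inv]
  field_simp
  ring

theorem uniform_mem_stdSimplex (p : ℕ) [NeZero p] :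
    (fun _ => (p : ℝ)⁻¹) ∈ stdSimplex ℝ (Fin p) := by
  have hp : (p : ℝ) ≠ 0 := by exact_mod_cast NeZero.ne p
  exact ⟨fun _ => by positivity, by simp [hp]⟩

/-- A minimizer is either constant or has a single distinguished coordinate, which reduces the
problem to the even two-level energy; the uniform vector sits at `-y₀`. -/
theorem uniform_mem_globalMinima_betaMF {p : ℕ} [NeZero p] (hp : 3 ≤ p) :
    (fun _ => (p : ℝ)⁻¹) ∈ globalMinima p (betaMF p) 0 := by
  have hp3 : (3 : ℝ) ≤ p := by exact_mod_cast hp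
  have hp1 : (p : ℝ) - 1 ≠ 0 := by linarith
  have hp2 : (p : ℝ) - 2 ≠ 0 := by linarith
  have hp0 : (p : ℝ) ≠ 0 := by linarith
  refine ⟨uniform_mem_stdSimplex p, fun y hy => ?_⟩
  obtain ⟨z, hz⟩ := globalMinima_nonempty p (betaMF p) 0
  refine le_trans ?_ (hz.2 y hy)
  rcases globalMinima_structure hz (F := Set.univ) (fun _ _ => Or.inr rfl) with hall | hone
  · have : z = fun _ => (p : ℝ)⁻¹ := by
      funext k
      have := hz.1.2
      rw [Finset.sum_congr rfl fun j _ => hall j trivial k trivial] at this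
      simp at this
      field_simp
      linarith
    rw [this]
  · obtain ⟨k, -, j, -, -, -, -, hl⟩ := hone
    have hsum := hz.1.2
    rw [sum_eq_add_of_forall_ne (k := k) (v := z j) fun l hlk => hl l trivial hlk] at hsum
    rw [pottsFreeEnergy_betaMF_eq hp (k := (0 : Fin p)) (b := (p : ℝ)⁻¹)
        (y := -(((p : ℝ) - 2) / (2 * p))) (by field_simp; ring) (fun _ _ => rfl)
        (by field_simp; ring),
      pottsFreeEnergy_betaMF_eq hp (k := k) (b := z j) (y := z k - 1 / 2) (by ring)
        (fun l hlk => hl l trivial hlk) (by linarith)]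
    have := two_level_energy_min (y₀ := ((p : ℝ) - 2) / (2 * p)) (y := z k - 1 / 2)
      (div_pos (by linarith) (by linarith))
      (by rw [div_lt_div_iff₀ (by linarith) (by norm_num)]; linarith)
      (log_sub_log_betaMF hp) (by
        have h1 := hz.1.1 k
        have h2 := mul_nonneg (by linarith : (0 : ℝ) ≤ p - 1) (hz.1.1 j)
        rw [abs_le]; constructor <;> linarith)
    simp only [sub_neg_eq_add, neg_sq, ← sub_eq_add_neg]
    linarith

/-- The mirror point `+y₀` has the same energy as the uniform vector. -/
theorem exists_nonuniform_mem_globalMinima_betaMF {p : ℕ} [NeZero p] (hp : 3 ≤ p) :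
    ∃ z ∈ globalMinima p (betaMF p) 0, 1 < (p : ℝ) * ∑ k, z k ^ 2 := by
  have hp3 : (3 : ℝ) ≤ p := by exact_mod_cast hp
  have hp1 : (p : ℝ) - 1 ≠ 0 := by linarith
  have hp2 : (p : ℝ) - 2 ≠ 0 := by linarith
  have hp0 : (p : ℝ) ≠ 0 := by linarith
  set z : Fin p → ℝ := fun k => if k = 0 then ((p : ℝ) - 1) / p else 1 / (p * (p - 1)) with hz
  have hz0 : z 0 = ((p : ℝ) - 1) / p := by simp [hz]
  have hzl : ∀ l, l ≠ 0 → z l = 1 / (p * (p - 1)) := fun l hl => by simp [hz, hl]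
  have hzs : z ∈ stdSimplex ℝ (Fin p) := by
    refine ⟨fun k => ?_, ?_⟩
    · have : (0 : ℝ) < p - 1 := by linarith
      simp only [hz]
      split_ifs <;> positivity
    · rw [sum_eq_add_of_forall_ne hzl, hz0]
      field_simp
      ring
  have hval : pottsFreeEnergy p (betaMF p) 0 z =
      pottsFreeEnergy p (betaMF p) 0 fun _ => (p : ℝ)⁻¹ := by
    rw [pottsFreeEnergy_betaMF_eq hp (k := (0 : Fin p)) (b := (p : ℝ)⁻¹)
        (y := -(((p : ℝ) - 2) / (2 * p))) (by field_simp; ring) (fun _ _ => rfl)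
        (by field_simp; ring),
      pottsFreeEnergy_betaMF_eq hp (k := (0 : Fin p)) (b := 1 / (p * (p - 1)))
        (y := (((p : ℝ) - 2) / (2 * p))) (by rw [hz0]; field_simp; ring) hzl
        (by field_simp; ring)]
    simp only [sub_neg_eq_add, neg_sq, ← sub_eq_add_neg]
    ring
  refine ⟨z, ⟨hzs, fun y hy => hval ▸ (uniform_mem_globalMinima_betaMF hp).2 y hy⟩, ?_⟩
  by_contra hcon
  push Not at hcon
  have := eq_inv_card_of_sum_sq_le hzs hcon 0
  rw [hz0] at this
  field_simp at this
  linarith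

/-- Below `betaMF` the sum of squares is at most its value `1 / p` at the uniform minimizer, the
least possible on the simplex. -/
theorem eq_uniform_of_lt_betaMF {p : ℕ} [NeZero p] (hp : 3 ≤ p) {β : ℝ} (hβ : β < betaMF p)
    {z : Fin p → ℝ} (hz : z ∈ globalMinima p β 0) (k : Fin p) : z k = (p : ℝ)⁻¹ := by
  have := sum_sq_le_of_globalMinima hβ hz (uniform_mem_globalMinima_betaMF hp)
  refine eq_inv_card_of_sum_sq_le hz.1 ?_ k
  have hp0 : (p : ℝ) ≠ 0 := by exact_mod_cast NeZero.ne p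
  have hp' : (0 : ℝ) ≤ p := by positivity
  refine (mul_le_mul_of_nonneg_left this hp').trans_eq ?_
  simp
  field_simp

theorem uniform_notMem_globalMinima {p : ℕ} [NeZero p] (hp : 3 ≤ p) {β : ℝ} (hβ : betaMF p < β) :
    (fun _ => (p : ℝ)⁻¹) ∉ globalMinima p β 0 := by
  intro hu
  obtain ⟨z, hz, hlt⟩ := exists_nonuniform_mem_globalMinima_betaMF hp
  have := sum_sq_le_of_globalMinima hβ hz hu
  have hp0 : (p : ℝ) ≠ 0 := by exact_mod_cast NeZero.ne p
  have hp' : (0 : ℝ) ≤ p := by positivity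
  have := mul_le_mul_of_nonneg_left this hp'
  simp at this
  field_simp at this
  linarith

/-! ### Conditioning on the first coordinate. -/

/-- Conditionally on the first coordinate, the free energy is a zero-field free energy. -/
theorem pottsFreeEnergy_cons {n : ℕ} [NeZero n] (β h a : ℝ) {s : ℝ} (hs : 0 < s) {z : Fin n → ℝ}
    (hz : ∑ k, z k = 1) :
    pottsFreeEnergy (n + 1) β h (Fin.cons a fun k => s * z k : Fin (n + 1) → ℝ) =
      -(β / 2) * a ^ 2 + a * Real.log a - h * a + s * Real.log s
        + s * pottsFreeEnergy n (β * s) 0 z := by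
  have key : ∀ k, -(β / 2) * (s * z k) ^ 2 + s * z k * Real.log (s * z k) =
      s * Real.log s * z k + s * (-(β * s / 2) * z k ^ 2 + z k * Real.log (z k)) := by
    intro k
    rcases eq_or_ne (z k) 0 with h0 | h0
    · simp [h0]
    · rw [Real.log_mul hs.ne' h0]; ring
  unfold pottsFreeEnergy
  rw [Fin.sum_univ_succ]
  simp only [Fin.cons_zero, Fin.cons_succ]
  rw [Finset.sum_congr rfl fun k _ => key k, Finset.sum_add_distrib, ← Finset.mul_sum,
    ← Finset.mul_sum, hz]
  ring

theorem cons_mem_stdSimplex {n : ℕ} {a : ℝ} (h0 : 0 ≤ a) (h1 : a ≤ 1) {z : Fin n → ℝ}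
    (hz : z ∈ stdSimplex ℝ (Fin n)) :
    (Fin.cons a fun k => (1 - a) * z k : Fin (n + 1) → ℝ) ∈ stdSimplex ℝ (Fin (n + 1)) := by
  refine ⟨fun k => ?_, ?_⟩
  · refine Fin.cases ?_ (fun k => ?_) k
    · simpa
    · simpa using mul_nonneg (by linarith) (hz.1 k)
  · rw [Fin.sum_univ_succ]
    simp only [Fin.cons_zero, Fin.cons_succ, ← Finset.mul_sum, hz.2]
    ring

theorem globalMinima_zero_lt_one {n : ℕ} [NeZero n] {β h : ℝ} {x : Fin (n + 1) → ℝ}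
    (hx : x ∈ globalMinima (n + 1) β h) : x 0 < 1 := by
  have h1 := hx.1.2
  rw [Fin.sum_univ_succ] at h1
  have : 0 < ∑ k : Fin n, x k.succ :=
    Finset.sum_pos (fun k _ => globalMinima_pos hx _) ⟨0, Finset.mem_univ _⟩
  linarith

/-- With the first coordinate fixed, the energy is an increasing affine function of the zero-field
energy of the normalized tail, so a better tail would lower it. -/
theorem tail_mem_globalMinima {n : ℕ} [NeZero n] {β h : ℝ} {x : Fin (n + 1) → ℝ}
    (hx : x ∈ globalMinima (n + 1) β h) :
    (fun k : Fin n => x k.succ / (1 - x 0)) ∈ globalMinima n (β * (1 - x 0)) 0 := by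
  have hs : 0 < 1 - x 0 := by linarith [globalMinima_zero_lt_one hx]
  have hsum := hx.1.2
  rw [Fin.sum_univ_succ] at hsum
  have hz : (fun k : Fin n => x k.succ / (1 - x 0)) ∈ stdSimplex ℝ (Fin n) := by
    refine ⟨fun k => div_nonneg (hx.1.1 _) hs.le, ?_⟩
    rw [← Finset.sum_div, div_eq_one_iff_eq hs.ne']
    linarith
  refine ⟨hz, fun y hy => ?_⟩
  have hxe : x = (Fin.cons (x 0) fun k => (1 - x 0) * (x k.succ / (1 - x 0)) :
      Fin (n + 1) → ℝ) := by
    funext k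
    refine Fin.cases ?_ (fun k => ?_) k
    · simp
    · simp only [Fin.cons_succ]
      field_simp
  have hmin := hx.2 _ (cons_mem_stdSimplex (hx.1.1 0) (by linarith) hy)
  have hval := pottsFreeEnergy_cons β h (x 0) hs hz.2
  rw [← hxe] at hval
  rw [hval, pottsFreeEnergy_cons β h (x 0) hs hy.2] at hmin
  exact le_of_mul_le_mul_left (by linarith) hs

theorem mul_le_betaMF_of_symmetric {n : ℕ} [NeZero n] (hn : 3 ≤ n) {β h : ℝ} {x : Fin (n + 1) → ℝ}
    (hx : x ∈ globalMinima (n + 1) β h) (hsym : ∀ j k, j ≠ 0 → k ≠ 0 → x j = x k) :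
    β * (1 - x 0) ≤ betaMF n := by
  by_contra hcon
  push Not at hcon
  have ht := tail_mem_globalMinima hx
  refine uniform_notMem_globalMinima hn hcon ?_
  convert ht using 1
  funext k
  have hsum := ht.1.2
  have hk : ∀ j : Fin n, x j.succ / (1 - x 0) = x k.succ / (1 - x 0) := fun j => by
    rw [hsym j.succ k.succ j.succ_ne_zero k.succ_ne_zero]
  simp only [hk] at hsum
  simp only [Finset.sum_const, Finset.card_univ, Fintype.card_fin, nsmul_eq_mul] at hsum
  exact inv_eq_of_mul_eq_one_right hsum

theorem betaMF_le_mul_of_asymmetric {n : ℕ} [NeZero n] (hn : 3 ≤ n) {β h : ℝ}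
    {x : Fin (n + 1) → ℝ} (hx : x ∈ globalMinima (n + 1) β h)
    (hasym : ¬ ∀ j k, j ≠ 0 → k ≠ 0 → x j = x k) : betaMF n ≤ β * (1 - x 0) := by
  by_contra hcon
  push Not at hcon
  have hs : 0 < 1 - x 0 := by linarith [globalMinima_zero_lt_one hx]
  have ht := eq_uniform_of_lt_betaMF hn hcon (tail_mem_globalMinima hx)
  refine hasym fun j k hj hk => ?_
  obtain ⟨j, rfl⟩ := Fin.exists_succ_eq.mpr hj
  obtain ⟨k, rfl⟩ := Fin.exists_succ_eq.mpr hk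
  have := (ht j).trans (ht k).symm
  exact (div_left_inj' hs.ne').mp this

theorem betaMF_pos {p : ℕ} (hp : 3 ≤ p) : 0 < betaMF p := by
  have hp3 : (3 : ℝ) ≤ p := by exact_mod_cast hp
  have := Real.log_pos (by linarith : (1 : ℝ) < p - 1)
  unfold betaMF
  have : 0 < ((p : ℝ) - 1) / (p - 2) := div_pos (by linarith) (by linarith)
  positivity

/-- Once a minimum is asymmetric, no minimum is symmetric at larger coupling. -/
theorem not_symmetric_of_asymmetric_of_lt {n : ℕ} [NeZero n] (hn : 3 ≤ n) {β β' h : ℝ} (hh : h < 0)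
    (hβ : β < β') {x y : Fin (n + 1) → ℝ} (hx : x ∈ globalMinima (n + 1) β h)
    (hy : y ∈ globalMinima (n + 1) β' h) (hasym : ¬ ∀ j k, j ≠ 0 → k ≠ 0 → x j = x k) :
    ¬ ∀ j k, j ≠ 0 → k ≠ 0 → y j = y k := by
  intro hsym
  have hnpos : (3 : ℝ) ≤ n := by exact_mod_cast hn
  have h1 := betaMF_le_mul_of_asymmetric hn hx hasym
  have h2 := mul_le_betaMF_of_symmetric hn hy hsym
  have hB := betaMF_pos hn
  have hsx : 0 < 1 - x 0 := by linarith [globalMinima_zero_lt_one hx]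
  have hsy : 0 < 1 - y 0 := by linarith [globalMinima_zero_lt_one hy]
  have hβ0 : 0 < β := pos_of_mul_pos_left (by linarith) hsx.le
  have hlt : x 0 < y 0 := by
    by_contra hcon
    push Not at hcon
    nlinarith
  have hE := sum_sq_le_of_globalMinima hβ hx hy
  rw [Fin.sum_univ_succ, Fin.sum_univ_succ (n := n)] at hE
  have hxs := hx.1.2
  have hys := hy.1.2
  rw [Fin.sum_univ_succ] at hxs hys
  set w := y (Fin.succ 0)
  have hyw : ∀ k : Fin n, y k.succ = w := fun k =>
    hsym _ _ k.succ_ne_zero (Fin.succ_ne_zero _)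
  have hyw0 : y 0 ≤ w := globalMinima_zero_le hh hy _
  simp only [hyw, Finset.sum_const, Finset.card_univ, Fintype.card_fin, nsmul_eq_mul] at hE hys
  -- Cauchy–Schwarz bounds the tail of `x` from below; for the constant tail of `y` it is an
  -- equality.
  have hcs := sq_sum_le_card_mul_sum_sq (s := Finset.univ) (f := fun k : Fin n => x k.succ)
  simp only [Finset.card_univ, Fintype.card_fin] at hcs
  have e1 : ∑ k : Fin n, x k.succ = 1 - x 0 := by linarith
  have e2 : (n : ℝ) * w = 1 - y 0 := by linarith
  rw [e1] at hcs
  have e3 : (n : ℝ) * (n * w ^ 2) = (1 - y 0) ^ 2 := by rw [← e2]; ring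
  have e4 : (n : ℝ) * x 0 ^ 2 + (1 - x 0) ^ 2 ≤ n * y 0 ^ 2 + (1 - y 0) ^ 2 := by
    have := mul_le_mul_of_nonneg_left hE (by linarith : (0 : ℝ) ≤ n)
    linarith
  -- The function `t ↦ n t² + (1 - t)²` strictly decreases up to `1 / (n + 1)`, so `x 0 < y 0 ≤ 1 /
  -- (n + 1)` contradicts `e4`.
  have e5 : ((n : ℝ) + 1) * y 0 ≤ 1 := by nlinarith
  have e6 : ((n : ℝ) + 1) * (x 0 + y 0) < 2 := by nlinarith
  nlinarith

/-! ### Estimates for pairs with equal values of `log t - t`. -/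

/-- The left side is the [2/2] Padé approximant at `1`; the difference vanishes there and has
derivative `(r - 1)⁴ / (r (r² + 4 r + 1)²)`. -/
theorem log_ge_pade {r : ℝ} (hr : 1 ≤ r) :
    3 * (r ^ 2 - 1) / (r ^ 2 + 4 * r + 1) ≤ Real.log r := by
  set f : ℝ → ℝ := fun r => Real.log r - 3 * (r ^ 2 - 1) / (r ^ 2 + 4 * r + 1)
  have hd : ∀ r : ℝ, 0 < r → HasDerivAt f ((r - 1) ^ 4 / (r * (r ^ 2 + 4 * r + 1) ^ 2)) r := by
    intro r hr
    have hD : r ^ 2 + 4 * r + 1 ≠ 0 := by positivity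
    have d1 : HasDerivAt (fun r : ℝ => 3 * (r ^ 2 - 1)) (3 * (2 * r)) r := by
      simpa using ((hasDerivAt_pow 2 r).sub_const 1).const_mul 3
    have d2 : HasDerivAt (fun r : ℝ => r ^ 2 + 4 * r + 1) (2 * r + 4) r := by
      simpa using (((hasDerivAt_pow 2 r).add ((hasDerivAt_id r).const_mul 4)).add_const 1)
    refine ((Real.hasDerivAt_log hr.ne').sub (d1.div d2 hD)).congr_deriv ?_
    field_simp
    ring
  have hmono : MonotoneOn f (Set.Ici 1) := by
    refine monotoneOn_of_deriv_nonneg (convex_Ici 1) ?_ ?_ ?_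
    · intro r hr
      exact (hd r (by linarith [Set.mem_Ici.mp hr])).continuousAt.continuousWithinAt
    · intro r hr
      rw [interior_Ici] at hr
      exact (hd r (by linarith [Set.mem_Ioi.mp hr])).differentiableAt.differentiableWithinAt
    · intro r hr
      rw [interior_Ici] at hr
      have : 0 < r := by linarith [Set.mem_Ioi.mp hr]
      rw [(hd r this).deriv]
      positivity
  have := hmono (Set.mem_Ici.mpr le_rfl) (Set.mem_Ici.mpr hr) hr
  simp [f] at this
  linarith

/-- Since `log (c / b) = c - b`, the Padé bound becomes `3 s ≤ s² + 2 p` with `s = b + c`, `p = b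
c`. With `p ≤ s² / 4` this gives `s ≥ 2`, and then `p ≥ s (3 - s) / 2 ≥ 3 - s` if `s ≤ 3`. -/
theorem add_add_mul_ge_three {b c : ℝ} (hb : 0 < b) (hbc : b < c)
    (h : Real.log b - b = Real.log c - c) : 3 ≤ b + c + b * c := by
  have hc := hb.trans hbc
  have hp := log_ge_pade (r := c / b) ((one_le_div hb).mpr hbc.le)
  rw [Real.log_div hc.ne' hb.ne', show Real.log c - Real.log b = c - b by linarith] at hp
  have e : 3 * ((c / b) ^ 2 - 1) / ((c / b) ^ 2 + 4 * (c / b) + 1) =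
      3 * ((c + b) * (c - b)) / (c ^ 2 + 4 * (b * c) + b ^ 2) := by
    field_simp
    ring
  rw [e, div_le_iff₀ (by positivity)] at hp
  have h1 : 3 * (b + c) ≤ (b + c) ^ 2 + 2 * (b * c) := by
    have : (c - b) * (3 * (b + c)) ≤ (c - b) * ((b + c) ^ 2 + 2 * (b * c)) := by linarith
    exact le_of_mul_le_mul_left this (by linarith)
  have h2 : 2 ≤ b + c := by
    by_contra hcon
    push Not at hcon
    nlinarith [sq_nonneg (b - c)]
  have h3 := mul_pos hb hc
  rcases le_total 3 (b + c) with h4 | h4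
  · linarith
  · nlinarith

theorem inv_sub_one_add_half_le {b c : ℝ} (hb : 0 < b) (hb1 : b < 1) (hc : 1 < c)
    (h : Real.log b - b = Real.log c - c) : (c - 1)⁻¹ + 1 / 2 ≤ (1 - b)⁻¹ := by
  have := add_add_mul_ge_three hb (hb1.trans hc) h
  have h1 : 0 < 1 - b := by linarith
  have h2 : 0 < c - 1 := by linarith
  rw [← sub_nonneg]
  have e : (1 - b)⁻¹ - ((c - 1)⁻¹ + 1 / 2) =
      (b + c + b * c - 3) / (2 * (1 - b) * (c - 1)) := by
    field_simp
    ring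
  rw [e]
  exact div_nonneg (by linarith) (by positivity)

theorem div_one_sub_eq {b : ℝ} (hb : b < 1) : b / (1 - b) = (1 - b)⁻¹ - 1 := by
  have : 1 - b ≠ 0 := by linarith
  field_simp
  ring

theorem div_sub_one_eq {c : ℝ} (hc : 1 < c) : c / (c - 1) = 1 + (c - 1)⁻¹ := by
  have : c - 1 ≠ 0 := by linarith
  field_simp
  ring

/-- The second order condition keeps the large coordinate away from the bifurcation point. -/
theorem inv_sub_one_le_two {N b c u : ℝ} (hN : 2 ≤ N) (hb : 0 < b) (hb1 : b < 1) (hc : 1 < c)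
    (hu : 0 < u) (hu1 : u < 1) (h : Real.log b - b = Real.log c - c)
    (hM : N * (b / (1 - b)) + u / (1 - u) ≤ c / (c - 1)) : (c - 1)⁻¹ ≤ 2 := by
  -- With `P = 1 / (1 - b)` and `C = 1 / (c - 1)`, the inequalities `2 (P - 1) ≤ 1 + C` and `C + 1/2
  -- ≤ P` give `C ≤ 2`.
  have h1 := inv_sub_one_add_half_le hb hb1 hc h
  have h2 : 0 < u / (1 - u) := div_pos hu (by linarith)
  have h3 : 0 < b / (1 - b) := div_pos hb (by linarith)
  rw [div_sub_one_eq hc] at hM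
  have h4 : 2 * (b / (1 - b)) ≤ N * (b / (1 - b)) := mul_le_mul_of_nonneg_right hN h3.le
  rw [div_one_sub_eq hb1] at h4 hM
  linarith

/-- Eliminating `c / (c - 1)` by `hM` leaves `N (P - 1)(P² - C²) + (U - 1)(U² - C²)` in the
reciprocals `P`, `U`, `C` of `1 - b`, `1 - u`, `c - 1`. From `P ≥ C + 1/2` the first term is at
least `(P - 1)(2 C + 1/2)`; from `1 < U < P` and `C ≤ 2` the second is at least `-(P - 1) 2 C`. -/
theorem second_order_crossing {N b c u : ℝ} (hN : 2 ≤ N) (hb1 : b < 1) (hc : 1 < c)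
    (hu : 0 < u) (hub : u < b) (h : Real.log b - b = Real.log c - c)
    (hM : N * (b / (1 - b)) + u / (1 - u) = c / (c - 1)) :
    0 < N * (b / (1 - b) ^ 3) + u / (1 - u) ^ 3 - c / (c - 1) ^ 3 := by
  have hb := hu.trans hub
  have hu1 := hub.trans hb1
  have h1 := inv_sub_one_add_half_le hb hb1 hc h
  have h2 := inv_sub_one_le_two hN hb hb1 hc hu hu1 h hM.le
  have eb : b / (1 - b) ^ 3 = (b / (1 - b)) * ((1 - b)⁻¹) ^ 2 := by
    have : 1 - b ≠ 0 := by linarith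
    field_simp
  have eu : u / (1 - u) ^ 3 = (u / (1 - u)) * ((1 - u)⁻¹) ^ 2 := by
    have : 1 - u ≠ 0 := by linarith
    field_simp
  have ec : c / (c - 1) ^ 3 = (c / (c - 1)) * ((c - 1)⁻¹) ^ 2 := by
    have : c - 1 ≠ 0 := by linarith
    field_simp
  rw [eb, eu, ec, ← hM, div_one_sub_eq hb1, div_one_sub_eq hu1]
  have hC : 0 < (c - 1)⁻¹ := inv_pos.mpr (by linarith)
  have hU : 1 < (1 - u)⁻¹ := (one_lt_inv₀ (by linarith)).mpr (by linarith)
  have hUP : (1 - u)⁻¹ < (1 - b)⁻¹ := inv_strictAnti₀ (by linarith) (by linarith)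
  generalize (1 - b)⁻¹ = P at *
  generalize (1 - u)⁻¹ = U at *
  generalize (c - 1)⁻¹ = C at *
  have key : (P - 1) * (2 * C + 1 / 2) ≤ N * (P - 1) * (P ^ 2 - C ^ 2) := by
    have e1 : 2 * C + 1 / 2 ≤ 2 * (P ^ 2 - C ^ 2) := by nlinarith
    have e2 : 0 ≤ (P - 1) * (P ^ 2 - C ^ 2) := mul_nonneg (by linarith) (by nlinarith)
    nlinarith
  have key2 : -((P - 1) * (2 * C)) ≤ (U - 1) * (U ^ 2 - C ^ 2) := by
    rcases le_total (C ^ 2) (U ^ 2) with hle | hle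
    · have := mul_nonneg (by linarith : 0 ≤ U - 1) (by linarith : 0 ≤ U ^ 2 - C ^ 2)
      have := mul_nonneg (by linarith : 0 ≤ P - 1) hC.le
      linarith
    · have e1 : (U - 1) * (C ^ 2 - U ^ 2) ≤ (P - 1) * (C ^ 2 - U ^ 2) :=
        mul_le_mul_of_nonneg_right (by linarith) (by linarith)
      have e2 : (P - 1) * (C ^ 2 - U ^ 2) ≤ (P - 1) * (2 * C) :=
        mul_le_mul_of_nonneg_left (by nlinarith) (by linarith)
      linarith
  have : 0 < (P - 1) * (1 / 2) := by linarith
  nlinarith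

/-! ### Uniqueness of asymmetric solutions. -/

/-- A function whose derivative crosses zero only upwards is decreasing up to any point with
nonpositive derivative. -/
theorem lt_of_deriv_upcrossing {f m m' : ℝ → ℝ} {e : ℝ} (hf : ∀ x < e, HasDerivAt f (m x) x)
    (hm : ∀ x < e, HasDerivAt m (m' x) x) (hcross : ∀ x < e, m x = 0 → 0 < m' x) {a b : ℝ}
    (hab : a < b) (hb : b < e) (hmb : m b ≤ 0) : f b < f a := by
  have hneg : ∀ x, x < b → m x < 0 := by
    intro x hxb
    by_contra hx
    push Not at hx
    -- Once nonnegative, `m` stays so, because it increases at each zero. Hence `m b = 0` is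
    -- approached from nonnegative values, against `0 < m' b`.
    have hnn : ∀ y ∈ Set.Icc x b, -m y ≤ 0 := by
      refine image_le_of_deriv_right_lt_deriv_boundary (f := fun y => -m y) (f' := fun y => -m' y)
        (B := fun _ => 0) (B' := fun _ => 0) ?_ ?_ (by simpa) (fun y => hasDerivAt_const y 0) ?_
      · intro y hy
        exact (hm y (hy.2.trans_lt hb)).neg.continuousAt.continuousWithinAt
      · intro y hy
        exact (hm y (hy.2.trans hb)).neg.hasDerivWithinAt
      · intro y hy hy0
        have := hcross y (hy.2.trans hb) (by simpa using hy0)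
        linarith
    have hb0 : m b = 0 := le_antisymm hmb (by linarith [hnn b ⟨hxb.le, le_rfl⟩])
    have hpos := hcross b hb hb0
    have hslope := (hasDerivAt_iff_tendsto_slope.mp (hm b hb)).mono_left
      (nhdsWithin_mono (s := Set.Iio b) b fun y hy => ne_of_lt hy)
    have : m' b ≤ 0 := by
      refine le_of_tendsto hslope ?_
      filter_upwards [Ioo_mem_nhdsLT hxb] with y hy
      rw [slope_def_field, hb0, sub_zero]
      exact div_nonpos_of_nonneg_of_nonpos (by linarith [hnn y ⟨hy.1.le, hy.2.le⟩])
        (by linarith [hy.2])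
    linarith
  have hanti : StrictAntiOn f (Set.Icc a b) := by
    refine strictAntiOn_of_deriv_neg (convex_Icc a b) ?_ ?_
    · intro y hy
      exact (hf y (hy.2.trans_lt hb)).continuousAt.continuousWithinAt
    · intro y hy
      rw [interior_Icc] at hy
      rw [(hf y (hy.2.trans hb)).deriv]
      exact hneg y hy.2
  exact hanti ⟨le_rfl, hab.le⟩ ⟨hab.le, le_rfl⟩ hab

theorem log_sub_self_lt {t : ℝ} (ht : 0 < t) (h1 : t ≠ 1) : Real.log t - t < -1 := by
  linarith [Real.log_lt_sub_one_of_pos ht h1]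

theorem hasStrictDerivAt_log_sub_self {t : ℝ} (ht : t ≠ 0) :
    HasStrictDerivAt (fun t => Real.log t - t) (t⁻¹ - 1) t :=
  (Real.hasStrictDerivAt_log ht).sub (hasStrictDerivAt_id t)

theorem eq_of_log_sub_self_eq_of_le_one {a b : ℝ} (ha : 0 < a) (hb : 0 < b) (ha1 : a ≤ 1)
    (hb1 : b ≤ 1) (h : Real.log a - a = Real.log b - b) : a = b :=
  eq_of_log_eq_of_mul_le_one (β := 1) ha hb (by simpa using h) (by simpa) (by simpa)

theorem eq_of_log_sub_self_eq_of_one_le {a b : ℝ} (ha1 : 1 ≤ a) (hb1 : 1 ≤ b)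
    (h : Real.log a - a = Real.log b - b) : a = b := by
  rcases lt_trichotomy a b with hlt | heq | hlt
  · linarith [(mul_lt_one_lt_mul_of_log_eq (β := 1) (by linarith) hlt (by simpa using h)).1]
  · exact heq
  · linarith [(mul_lt_one_lt_mul_of_log_eq (β := 1) (by linarith) hlt (by simpa using h.symm)).1]

/-- The inverse of `t ↦ log t - t` on `(0, 1)`. -/
theorem exists_log_sub_self_lower_inverse : ∃ g : ℝ → ℝ, ∀ l < -1,
    0 < g l ∧ g l < 1 ∧ Real.log (g l) - g l = l ∧ HasDerivAt g (g l / (1 - g l)) l := by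
  have hex : ∀ l : ℝ, ∃ t, l < -1 → 0 < t ∧ t < 1 ∧ Real.log t - t = l := by
    intro l
    by_cases hl : l < -1
    · have hE := Real.exp_pos l
      have hE1 : Real.exp l ≤ 1 := Real.exp_le_one_iff.mpr (by linarith)
      have hcont : ContinuousOn (fun t => Real.log t - t) (Set.Icc (Real.exp l) 1) := fun t ht =>
        (hasStrictDerivAt_log_sub_self (hE.trans_le ht.1).ne').hasDerivAt.continuousAt.continuousWithinAt
      obtain ⟨t, ht, hlt⟩ := intermediate_value_Icc hE1 hcont
        (show l ∈ _ from ⟨by rw [Real.log_exp]; linarith, by rw [Real.log_one]; linarith⟩)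
      refine ⟨t, fun _ => ⟨hE.trans_le ht.1, lt_of_le_of_ne ht.2 ?_, hlt⟩⟩
      rintro rfl
      simp at hlt
      linarith
    · exact ⟨0, fun h => absurd h hl⟩
  choose g hg using hex
  refine ⟨g, fun l hl => ?_⟩
  obtain ⟨h0, h1, h2⟩ := hg l hl
  refine ⟨h0, h1, h2, ?_⟩
  have hne : (g l)⁻¹ - 1 ≠ 0 := by
    have : 1 < (g l)⁻¹ := (one_lt_inv₀ h0).mpr h1
    linarith
  have := (hasStrictDerivAt_log_sub_self h0.ne').to_local_left_inverse (g := g) hne (by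
    filter_upwards [Ioo_mem_nhds h0 h1] with t ht
    obtain ⟨e0, e1, e2⟩ := hg _ (log_sub_self_lt ht.1 ht.2.ne)
    exact eq_of_log_sub_self_eq_of_le_one e0 ht.1 e1.le ht.2.le e2)
  rw [h2] at this
  refine this.hasDerivAt.congr_deriv ?_
  have : 1 - g l ≠ 0 := by linarith
  field_simp

/-- The inverse of `t ↦ log t - t` on `(1, ∞)`. -/
theorem exists_log_sub_self_upper_inverse : ∃ g : ℝ → ℝ, ∀ l < -1,
    1 < g l ∧ Real.log (g l) - g l = l ∧ HasDerivAt g (-(g l / (g l - 1))) l := by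
  have hex : ∀ l : ℝ, ∃ t, l < -1 → 1 < t ∧ Real.log t - t = l := by
    intro l
    by_cases hl : l < -1
    · have hcont : ContinuousOn (fun t => Real.log t - t) (Set.Icc 1 (-2 * l)) := fun t ht =>
        (hasStrictDerivAt_log_sub_self
          (zero_lt_one.trans_le ht.1).ne').hasDerivAt.continuousAt.continuousWithinAt
      -- The endpoint `-2 l` is low enough: `log 2 + log (-l) ≤ 1 + (-l - 1) = -l`.
      have hup : Real.log (-2 * l) - -2 * l ≤ l := by
        have e1 := Real.log_le_sub_one_of_pos (by linarith : 0 < -l)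
        have e2 := Real.log_le_sub_one_of_pos (by norm_num : (0 : ℝ) < 2)
        rw [show -2 * l = 2 * -l by ring, Real.log_mul (by norm_num) (by linarith)]
        linarith
      obtain ⟨t, ht, hlt⟩ := intermediate_value_Icc' (by linarith : (1 : ℝ) ≤ -2 * l) hcont
        (show l ∈ _ from ⟨hup, by rw [Real.log_one]; linarith⟩)
      refine ⟨t, fun _ => ⟨lt_of_le_of_ne ht.1 ?_, hlt⟩⟩
      rintro rfl
      simp at hlt
      linarith
    · exact ⟨0, fun h => absurd h hl⟩
  choose g hg using hex
  refine ⟨g, fun l hl => ?_⟩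
  obtain ⟨h1, h2⟩ := hg l hl
  refine ⟨h1, h2, ?_⟩
  have h0 : 0 < g l := by linarith
  have hne : (g l)⁻¹ - 1 ≠ 0 := by
    have : (g l)⁻¹ < 1 := inv_lt_one_of_one_lt₀ h1
    linarith
  have := (hasStrictDerivAt_log_sub_self h0.ne').to_local_left_inverse (g := g) hne (by
    filter_upwards [Ioi_mem_nhds h1] with t ht
    have ht1 : 1 < t := ht
    obtain ⟨e1, e2⟩ := hg _ (log_sub_self_lt (by linarith) ht1.ne')
    exact eq_of_log_sub_self_eq_of_one_le e1.le ht1.le e2)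
  rw [h2] at this
  refine this.hasDerivAt.congr_deriv ?_
  have e1 : (g l)⁻¹ - 1 = -((g l - 1) / g l) := by field_simp; ring
  rw [e1, inv_neg, inv_div]

/-- Uniqueness of solutions of the mean-field equations (in the variables `β x`) that satisfy the
second order condition. -/
theorem asymmetric_solution_unique {N h : ℝ} (hN : 2 ≤ N) (hh : h < 0) {u b c u' b' c' : ℝ}
    (hu : 0 < u) (hub : u < b) (hb : b < 1) (hc : 1 < c) (hbc : Real.log b - b = Real.log c - c)
    (hubl : Real.log u - u = Real.log b - b + h)
    (hM : N * (b / (1 - b)) + u / (1 - u) ≤ c / (c - 1))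
    (hu' : 0 < u') (hub' : u' < b') (hb' : b' < 1) (hc' : 1 < c')
    (hbc' : Real.log b' - b' = Real.log c' - c')
    (hubl' : Real.log u' - u' = Real.log b' - b' + h)
    (hM' : N * (b' / (1 - b')) + u' / (1 - u') ≤ c' / (c' - 1))
    (hsum : u + N * b + c = u' + N * b' + c') : u = u' ∧ b = b' ∧ c = c' := by
  obtain ⟨lo, hlo⟩ := exists_log_sub_self_lower_inverse
  obtain ⟨hi, hhi⟩ := exists_log_sub_self_upper_inverse
  -- Solutions are parametrized by the common level `l` of `b` and `c`, with `u` at level `l + h`.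
  -- Here `f` is the total mass, `m = f'` and `m' = f''`; the second order condition reads `m ≤ 0`.
  set f : ℝ → ℝ := fun l => lo (l + h) + N * lo l + hi l
  set m : ℝ → ℝ := fun l => N * (lo l / (1 - lo l)) + lo (l + h) / (1 - lo (l + h))
    - hi l / (hi l - 1)
  set m' : ℝ → ℝ := fun l => N * (lo l / (1 - lo l) ^ 3) + lo (l + h) / (1 - lo (l + h)) ^ 3
    - hi l / (hi l - 1) ^ 3
  have hshift : ∀ l < -1, HasDerivAt (fun l => lo (l + h)) (lo (l + h) / (1 - lo (l + h))) l :=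
    fun l hl => (hlo (l + h) (by linarith)).2.2.2.comp_add_const l h
  have hf : ∀ l < -1, HasDerivAt f (m l) l := by
    intro l hl
    refine (((hshift l hl).add ((hlo l hl).2.2.2.const_mul N)).add (hhi l hl).2.2).congr_deriv ?_
    simp only [m]
    ring
  have hquot : ∀ (g : ℝ → ℝ) (l : ℝ), g l ≠ 1 → HasDerivAt g (g l / (1 - g l)) l →
      HasDerivAt (fun l => g l / (1 - g l)) (g l / (1 - g l) ^ 3) l := by
    intro g l hg1 hg
    have hne : 1 - g l ≠ 0 := sub_ne_zero.mpr hg1.symm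
    refine (hg.div (hg.const_sub 1) hne).congr_deriv ?_
    field_simp
    ring
  have hm : ∀ l < -1, HasDerivAt m (m' l) l := by
    intro l hl
    have d1 := hquot lo l (hlo l hl).2.1.ne (hlo l hl).2.2.2
    have d2 := hquot (fun l => lo (l + h)) l (hlo _ (by linarith)).2.1.ne (hshift l hl)
    have hne : hi l - 1 ≠ 0 := by linarith [(hhi l hl).1]
    have d3 := (hhi l hl).2.2.div ((hhi l hl).2.2.sub_const 1) hne
    refine (((d1.const_mul N).add d2).sub d3).congr_deriv ?_
    simp only [m']
    have : (-(hi l / (hi l - 1)) * (hi l - 1) - hi l * -(hi l / (hi l - 1))) / (hi l - 1) ^ 2 =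
        hi l / (hi l - 1) ^ 3 := by
      field_simp
      ring
    rw [this]
  have hcross : ∀ l < -1, m l = 0 → 0 < m' l := by
    intro l hl hml
    obtain ⟨a1, a2, a3, -⟩ := hlo l hl
    obtain ⟨b1, b2, b3, -⟩ := hlo (l + h) (by linarith)
    obtain ⟨c1, c2, -⟩ := hhi l hl
    refine second_order_crossing hN a2 c1 b1 ?_ (a3.trans c2.symm) (by simp only [m] at hml; linarith)
    by_contra hcon
    push Not at hcon
    rcases hcon.eq_or_lt with heq | hlt
    · rw [heq] at a3; linarith
    · have e1 := Real.log_lt_sub_one_of_pos (div_pos a1 b1)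
        (by rw [ne_eq, div_eq_one_iff_eq b1.ne']; exact hlt.ne)
      rw [Real.log_div a1.ne' b1.ne'] at e1
      have e2 := Real.log_lt_sub_one_of_pos (div_pos b1 a1)
        (by rw [ne_eq, div_eq_one_iff_eq a1.ne']; exact hlt.ne')
      rw [Real.log_div b1.ne' a1.ne'] at e2
      have e3 : lo (l + h) / lo l - 1 = (lo (l + h) - lo l) / lo l := by field_simp
      have e4 : lo l / lo (l + h) - 1 = -((lo (l + h) - lo l) / lo (l + h)) := by
        field_simp; ring
      have e5 : lo (l + h) - lo l ≤ (lo (l + h) - lo l) / lo (l + h) := by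
        rw [le_div_iff₀ b1]; nlinarith
      linarith
  have hrep : ∀ u b c : ℝ, 0 < u → u < b → b < 1 → 1 < c → Real.log b - b = Real.log c - c →
      Real.log u - u = Real.log b - b + h →
      Real.log b - b < -1 ∧ lo (Real.log b - b) = b ∧ lo (Real.log b - b + h) = u ∧
        hi (Real.log b - b) = c := by
    intro u b c hu hub hb hc hbc hubl
    have hl : Real.log b - b < -1 := log_sub_self_lt (hu.trans hub) hb.ne
    obtain ⟨a1, a2, a3, -⟩ := hlo _ hl
    obtain ⟨b1, b2, b3, -⟩ := hlo (Real.log b - b + h) (by linarith)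
    obtain ⟨c1, c2, -⟩ := hhi _ hl
    exact ⟨hl, eq_of_log_sub_self_eq_of_le_one a1 (hu.trans hub) a2.le hb.le a3,
      eq_of_log_sub_self_eq_of_le_one b1 hu b2.le (hub.trans hb).le (b3.trans hubl.symm),
      eq_of_log_sub_self_eq_of_one_le c1.le hc.le (c2.trans hbc)⟩
  obtain ⟨r1, r2, r3, r4⟩ := hrep u b c hu hub hb hc hbc hubl
  obtain ⟨s1, s2, s3, s4⟩ := hrep u' b' c' hu' hub' hb' hc' hbc' hubl'
  rcases lt_trichotomy (Real.log b - b) (Real.log b' - b') with hlt | heq | hlt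
  -- Nonpositivity of `m` at the larger level makes the mass there strictly smaller, against `hsum`.
  · have := lt_of_deriv_upcrossing hf hm hcross hlt s1 (by simp only [m, s2, s3, s4]; linarith)
    simp only [f, r2, r3, r4, s2, s3, s4] at this
    linarith
  · rw [← heq] at s2 s3 s4
    exact ⟨r3.symm.trans s3, r2.symm.trans s2, r4.symm.trans s4⟩
  · have := lt_of_deriv_upcrossing hf hm hcross hlt r1 (by simp only [m, r2, r3, r4]; linarith)
    simp only [f, r2, r3, r4, s2, s3, s4] at this
    linarith

/-! ### The scalar equation for symmetric minima. -/

theorem convexOn_log_one_add_sub_log_one_sub {N : ℝ} (hN : 1 ≤ N) :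
    ConvexOn ℝ (Set.Ico 0 (1 / N)) fun t : ℝ => Real.log (1 + t) - Real.log (1 - N * t) := by
  have hpos : ∀ t : ℝ, t < 1 / N → 0 < 1 - N * t := fun t ht => by
    rw [lt_div_iff₀ (by linarith)] at ht
    linarith
  have hd : ∀ t : ℝ, 0 ≤ t → t < 1 / N → HasDerivAt
      (fun t : ℝ => Real.log (1 + t) - Real.log (1 - N * t))
      ((1 + N) / ((1 + t) * (1 - N * t))) t := by
    intro t h0 h1
    have h2 := hpos t h1
    have h3 : 0 < 1 + t := by linarith
    have d1 := ((hasDerivAt_id' t).const_add 1).log h3.ne'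
    have d2 := (((hasDerivAt_id' t).const_mul N).const_sub 1).log h2.ne'
    refine (d1.sub d2).congr_deriv ?_
    rw [div_sub_div _ _ h3.ne' h2.ne']
    congr 1
    ring
  refine MonotoneOn.convexOn_of_deriv (convex_Ico _ _) ?_ ?_ ?_
  · exact fun t ht => (hd t ht.1 ht.2).continuousAt.continuousWithinAt
  · intro t ht
    rw [interior_Ico] at ht
    exact (hd t ht.1.le ht.2).differentiableAt.differentiableWithinAt
  · intro s hs t ht hst
    rw [interior_Ico] at hs ht
    rw [(hd s hs.1.le hs.2).deriv, (hd t ht.1.le ht.2).deriv]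
    obtain ⟨hs1, hs2⟩ := hs
    obtain ⟨ht1, ht2⟩ := ht
    have h2 := hpos t ht2
    refine div_le_div_of_nonneg_left (by linarith) (by positivity) ?_
    nlinarith [mul_le_mul hst hst hs1.le ht1.le, mul_nonneg (sub_nonneg.mpr hN) (sub_nonneg.mpr hst)]

/-- Clearing denominators gives `exp (β θ - h) (1 - (q - 1) θ) = 1 + θ`; its logarithm equates a
convex function vanishing at `0` with an affine one. -/
theorem SymEquation.lt_and_log_eq {q : ℕ} (hq : 2 ≤ q) {β h θ : ℝ} (h0 : 0 ≤ θ)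
    (hs : SymEquation q β h θ) : θ < 1 / ((q : ℝ) - 1) ∧
      Real.log (1 + θ) - Real.log (1 - ((q : ℝ) - 1) * θ) = β * θ - h := by
  have hq2 : (2 : ℝ) ≤ q := by exact_mod_cast hq
  have hE := Real.exp_pos (β * θ - h)
  have hN : 0 < (q : ℝ) - 1 := by linarith
  have hD : 0 < ((q : ℝ) - 1) * Real.exp (β * θ - h) + 1 := by positivity
  unfold SymEquation at hs
  set E := Real.exp (β * θ - h) with hEdef
  rw [eq_div_iff hD.ne'] at hs
  have h1 : E * (1 - ((q : ℝ) - 1) * θ) = 1 + θ := by linarith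
  have h2 : 0 < 1 - ((q : ℝ) - 1) * θ :=
    (pos_iff_pos_of_mul_pos (by rw [h1]; linarith)).mp hE
  refine ⟨by rw [lt_div_iff₀ hN]; linarith, ?_⟩
  rw [← h1, Real.log_mul hE.ne' h2.ne', hEdef, Real.log_exp]
  ring

theorem existsUnique_symEquation {q : ℕ} (hq : 2 ≤ q) {β h : ℝ} (hh : h < 0) :
    ∃! θ : ℝ, θ ∈ Set.Icc 0 (1 / ((q : ℝ) - 1)) ∧ SymEquation q β h θ := by
  have hq2 : (2 : ℝ) ≤ q := by exact_mod_cast hq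
  have hN : 0 < (q : ℝ) - 1 := by linarith
  refine existsUnique_of_exists_of_unique ?_ ?_
  · set F : ℝ → ℝ := fun θ =>
      (Real.exp (β * θ - h) - 1) / (((q : ℝ) - 1) * Real.exp (β * θ - h) + 1) - θ
    have hD : ∀ θ, 0 < ((q : ℝ) - 1) * Real.exp (β * θ - h) + 1 := fun θ => by positivity
    have hF : Continuous F :=
      (Continuous.div (by fun_prop) (by fun_prop) fun θ => (hD θ).ne').sub continuous_id
    have h0 : 0 ≤ F 0 := by
      have : 1 ≤ Real.exp (β * 0 - h) := Real.one_le_exp (by linarith)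
      simp only [F, sub_zero]
      exact div_nonneg (by linarith) (hD 0).le
    have h1 : F (1 / ((q : ℝ) - 1)) ≤ 0 := by
      simp only [F]
      rw [sub_nonpos, div_le_div_iff₀ (hD _) hN]
      linarith
    obtain ⟨θ, hθ, hz⟩ := intermediate_value_Icc' (by positivity) hF.continuousOn
      (show (0 : ℝ) ∈ _ from ⟨h1, h0⟩)
    exact ⟨θ, hθ, by unfold SymEquation; simp only [F] at hz; linarith⟩
  · have hconv := convexOn_log_one_add_sub_log_one_sub (N := (q : ℝ) - 1) (by linarith)
    have hwlog : ∀ s t : ℝ, 0 ≤ s → 0 ≤ t → SymEquation q β h s → SymEquation q β h t →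
        ¬ s < t := by
      intro s t hs0 ht0 hs ht hst
      obtain ⟨-, e1⟩ := hs.lt_and_log_eq hq hs0
      obtain ⟨l2, e2⟩ := ht.lt_and_log_eq hq ht0
      have ht1 : 0 < t := hs0.trans_lt hst
      -- The convex side satisfies `t f(s) ≤ s f(t)`; inserting `f θ = β θ - h` leaves `-h t ≤ -h
      -- s`, impossible for `s < t`.
      have := hconv.mul_le_mul_of_zero ⟨le_rfl, by positivity⟩ (by simp) hs0 hst.le ht1 ⟨ht0, l2⟩
      rw [e1, e2] at this
      nlinarith
    intro s t hs ht
    exact le_antisymm (not_lt.mp (hwlog t s ht.1.1 hs.1.1 ht.2 hs.2))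
      (not_lt.mp (hwlog s t hs.1.1 ht.1.1 hs.2 ht.2))

/-- A symmetric global minimum is given by a solution of the scalar mean-field equation. -/
theorem exists_eq_symVec_of_symmetric {n : ℕ} [NeZero n] {β h : ℝ} (hh : h < 0)
    {x : Fin (n + 1) → ℝ} (hx : x ∈ globalMinima (n + 1) β h)
    (hsym : ∀ j k, j ≠ 0 → k ≠ 0 → x j = x k) :
    ∃ m, x = symVec (n + 1) m ∧
      ((n + 1 : ℕ) : ℝ) / (((n + 1 : ℕ) : ℝ) - 1) * m ∈
        Set.Icc 0 (1 / (((n + 1 : ℕ) : ℝ) - 1)) ∧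
      SymEquation (n + 1) β h (((n + 1 : ℕ) : ℝ) / (((n + 1 : ℕ) : ℝ) - 1) * m) := by
  have hn : (0 : ℝ) < n := by exact_mod_cast NeZero.pos n
  have hk0 : (Fin.succ 0 : Fin (n + 1)) ≠ 0 := Fin.succ_ne_zero _
  have hlt := globalMinima_zero_lt hh hx hk0
  have hlog := globalMinima_log_eq_field hx hk0
  have hpos0 := globalMinima_pos hx 0
  have hsum := hx.1.2
  set w := x (Fin.succ 0)
  have hw : ∀ k, k ≠ 0 → x k = w := fun k hk => hsym _ _ hk hk0
  have hwpos : 0 < w := hpos0.trans hlt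
  rw [Fin.sum_univ_succ] at hsum
  simp only [hw _ (Fin.succ_ne_zero _), Finset.sum_const, Finset.card_univ, Fintype.card_fin,
    nsmul_eq_mul] at hsum
  have hx0 : x 0 = 1 - n * w := by linarith
  have hm : ((n + 1 : ℕ) : ℝ) / (((n + 1 : ℕ) : ℝ) - 1) * (n / (n + 1) * (w - x 0)) = w - x 0 := by
    push_cast
    rw [add_sub_cancel_right]
    field_simp
  refine ⟨n / (n + 1) * (w - x 0), ?_, ?_, ?_⟩
  · funext k
    unfold symVec
    push_cast
    rw [add_sub_cancel_right]
    split_ifs with hk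
    · rw [show k = 0 from Fin.ext hk, hx0]
      field_simp
      ring
    · rw [hw k fun h => hk (by rw [h]; rfl), hx0]
      field_simp
      ring
  · rw [hm]
    refine ⟨by linarith, ?_⟩
    push_cast
    rw [add_sub_cancel_right, le_div_iff₀ hn]
    nlinarith
  · rw [hm]
    unfold SymEquation
    -- The exponentiated first order condition, with `θ = w - x 0`.
    have hE : Real.exp (β * (w - x 0) - h) = w / x 0 := by
      rw [show β * (w - x 0) - h = Real.log w - Real.log (x 0) by linarith,
        ← Real.log_div hwpos.ne' hpos0.ne', Real.exp_log (by positivity)]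
    rw [hE]
    push_cast
    rw [add_sub_cancel_right, eq_div_iff (by positivity)]
    have : (w - x 0) * (n * (w / x 0) + 1) = (w - x 0) * (n * w + x 0) / x 0 := by field_simp
    rw [this, show (n : ℝ) * w + x 0 = 1 by linarith]
    field_simp

/-! ### Symmetric vectors and permutation orbits. -/

theorem symVec_symmetric (q : ℕ) [NeZero q] (m : ℝ) (j k : Fin q) (hj : j ≠ 0) (hk : k ≠ 0) :
    symVec q m j = symVec q m k := by
  have h : ∀ l : Fin q, l ≠ 0 → l.val ≠ 0 := fun l hl h0 => hl (Fin.ext (by simpa using h0))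
  simp [symVec, h j hj, h k hk]

theorem symVec_injective (q : ℕ) [NeZero q] : Function.Injective (symVec q) := by
  intro m m' h
  have := congrFun h 0
  simp [symVec] at this
  exact this

theorem comp_perm_mem_globalMinima {q : ℕ} [NeZero q] {β h : ℝ} {x : Fin q → ℝ}
    (hx : x ∈ globalMinima q β h) {σ : Equiv.Perm (Fin q)} (hσ : σ 0 = 0) :
    x ∘ σ ∈ globalMinima q β h := by
  refine ⟨⟨fun k => hx.1.1 _, ?_⟩, fun y hy => ?_⟩
  · rw [← hx.1.2]
    exact Equiv.sum_comp σ x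
  · refine le_trans (le_of_eq ?_) (hx.2 y hy)
    unfold pottsFreeEnergy
    simp only [Function.comp_apply, hσ]
    rw [Equiv.sum_comp σ fun k => -(β / 2) * x k ^ 2 + x k * Real.log (x k)]

theorem blockVec_comp_swap {n : ℕ} [NeZero n] (a b c : ℝ) {k : Fin (n + 1)} (hk : k ≠ 0) :
    blockVec (n + 1) a b c ∘ Equiv.swap k (Fin.last n) =
      fun l => if l = 0 then a else if l = k then c else b := by
  have hn : n ≠ 0 := NeZero.ne n
  have hlast : Fin.last n ≠ 0 := Fin.last_pos'.ne'
  have hval : ∀ l : Fin (n + 1), l.val = 0 ↔ l = 0 := fun l => by simp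
  have hvl : ∀ l : Fin (n + 1), l.val = n + 1 - 1 ↔ l = Fin.last n := fun l => by
    rw [Fin.ext_iff]; simp
  funext l
  simp only [Function.comp_apply, blockVec, hval, hvl]
  rcases eq_or_ne l 0 with rfl | hl0
  · rw [Equiv.swap_apply_of_ne_of_ne hk.symm hlast.symm]; simp
  rcases eq_or_ne l k with rfl | hlk
  · simp [hlast, hl0]
  rcases eq_or_ne l (Fin.last n) with rfl | hll
  · simp [hlk, hlk.symm, hk, hl0]
  · rw [Equiv.swap_apply_of_ne_of_ne hlk hll]
    simp [hl0, hlk, hll]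

/-- A permutation fixing `0` matters only through the position where `c` lands. -/
theorem lastPerms_blockVec {n : ℕ} [NeZero n] (a b c : ℝ) :
    lastPerms (n + 1) (blockVec (n + 1) a b c) =
      (fun k l => if l = 0 then a else if l = k then c else b) '' {k : Fin (n + 1) | k ≠ 0} := by
  have hlast : Fin.last n ≠ 0 := Fin.last_pos'.ne'
  ext x
  constructor
  · rintro ⟨σ, hσ, rfl⟩
    have h0 : σ.symm 0 = 0 := by rw [Equiv.symm_apply_eq, hσ]
    refine ⟨σ.symm (Fin.last n), ?_, ?_⟩
    · intro h
      rw [Equiv.symm_apply_eq, hσ] at h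
      exact hlast h
    · funext l
      have hval : (σ l).val = 0 ↔ l = 0 := by
        rw [Fin.val_eq_zero_iff, ← Equiv.eq_symm_apply, h0]
      have hvl : (σ l).val = n + 1 - 1 ↔ l = σ.symm (Fin.last n) := by
        rw [Equiv.eq_symm_apply, Fin.ext_iff]; simp
      simp only [Function.comp_apply, blockVec, hval, hvl]
  · rintro ⟨k, hk, rfl⟩
    refine ⟨Equiv.swap k (Fin.last n), ?_, (blockVec_comp_swap a b c hk).symm⟩
    exact Equiv.swap_apply_of_ne_of_ne (Ne.symm hk) hlast.symm

theorem ncard_lastPerms_blockVec {n : ℕ} [NeZero n] (a : ℝ) {b c : ℝ} (hbc : b ≠ c) :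
    (lastPerms (n + 1) (blockVec (n + 1) a b c)).ncard = n := by
  rw [lastPerms_blockVec, Set.InjOn.ncard_image]
  · have : {k : Fin (n + 1) | k ≠ 0} = ({0} : Set (Fin (n + 1)))ᶜ := rfl
    rw [this, Set.ncard_compl]
    simp
  · intro k hk k' hk' heq
    have h1 := congrFun heq k
    by_contra hne
    simp only [show k ≠ 0 from hk, if_false, if_true, hne] at h1
    exact hbc h1.symm

/-! ### Asymmetric minima. -/

/-- The shape of asymmetric minima, with the second order condition in the variables `β x`. -/
theorem asymmetric_structure {n : ℕ} [NeZero n] {β h : ℝ} (hh : h < 0)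
    {x : Fin (n + 1) → ℝ} (hx : x ∈ globalMinima (n + 1) β h)
    (hasym : ¬ ∀ j k, j ≠ 0 → k ≠ 0 → x j = x k) :
    ∃ k ≠ 0, ∃ a b c, 0 < a ∧ a < b ∧ b < c ∧ 0 < β ∧ β * b < 1 ∧ 1 < β * c ∧
      (x = fun l => if l = 0 then a else if l = k then c else b) ∧
      a + ((n : ℝ) - 1) * b + c = 1 ∧ Real.log b - β * b = Real.log c - β * c ∧
      Real.log a - β * a = Real.log b - β * b + h ∧
      ((n : ℝ) - 1) * (β * b / (1 - β * b)) + β * a / (1 - β * a) ≤ β * c / (β * c - 1) := by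
  rcases globalMinima_structure hx (F := {k | k ≠ 0}) (fun j hj => Or.inl hj) with hall | hone
  · exact absurd (fun j k hj hk => hall j hj k hk) hasym
  obtain ⟨k, hk, j, hj, hlt, hb1, hc1, hl⟩ := hone
  have hk : k ≠ 0 := hk
  have hj : j ≠ 0 := hj
  have hjk : j ≠ k := by rintro rfl; exact lt_irrefl _ hlt
  have hl : ∀ l, l ≠ 0 → l ≠ k → x l = x j := hl
  have ha := globalMinima_pos hx 0
  have hab := globalMinima_zero_lt hh hx hj
  have hb := globalMinima_pos hx j
  have hc := globalMinima_pos hx k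
  have hβ : 0 < β := pos_of_mul_pos_left (by linarith) hc.le
  obtain ⟨k', rfl⟩ := Fin.exists_succ_eq.mpr hk
  have hl' : ∀ l, l ≠ k' → x l.succ = x j := fun l hlk =>
    hl _ l.succ_ne_zero fun h => hlk (Fin.succ_injective _ h)
  refine ⟨k'.succ, hk, x 0, x j, x k'.succ, ha, hab, hlt, hβ, hb1, hc1, ?_, ?_,
    globalMinima_log_eq hx (Or.inl hj) (Or.inl hk), globalMinima_log_eq_field hx hj, ?_⟩
  · funext l
    split_ifs with h1 h2
    · rw [h1]
    · rw [h2]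
    · exact hl l h1 h2
  · have := hx.1.2
    rw [Fin.sum_univ_succ, sum_eq_add_of_forall_ne hl'] at this
    linarith
  · set a := x 0
    set b := x j
    set c := x k'.succ
    have hn : (1 : ℝ) ≤ n := by exact_mod_cast NeZero.one_le
    have ha1 : β * a < 1 := by nlinarith
    have hA : 0 < β * a / (1 - β * a) := div_pos (by positivity) (by linarith)
    have hB : 0 < β * b / (1 - β * b) := div_pos (by positivity) (by linarith)
    set A := β * a / (1 - β * a) with hAdef
    set B := β * b / (1 - β * b) with hBdef
    set T := ((n : ℝ) - 1) * B + A with hT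
    have hTpos : 0 < T := by
      have := mul_nonneg (by linarith : 0 ≤ (n : ℝ) - 1) hB.le
      linarith
    -- Off `k'.succ` the direction is proportional to the inverse of the Hessian entries `1 / x_l -
    -- β`, which is optimal for a given total. Each such entry contributes `β v_l`, so the second
    -- variation is `β T - T² (β c - 1) / c`.
    set v : Fin (n + 1) → ℝ := Fin.cons A fun l => if l = k' then -T else B with hv
    have hv0 : ∑ l, v l = 0 := by
      rw [Fin.sum_univ_succ, sum_eq_add_of_forall_ne (k := k') (v := B)
        (by intro l hlk; simp [hv, hlk])]
      simp only [hv, Fin.cons_zero, Fin.cons_succ, if_true, hT]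
      ring
    have hsoc := (globalMinima_order_conditions hx hv0).2
    rw [Fin.sum_univ_succ, sum_eq_add_of_forall_ne (k := k') (v := B ^ 2 * (b⁻¹ - β))
        (by intro l hlk; simp [hv, hlk, hl' l hlk])] at hsoc
    simp only [hv, Fin.cons_zero, Fin.cons_succ, if_true] at hsoc
    have eA : A ^ 2 * (a⁻¹ - β) = β * A := by
      rw [hAdef]
      have : 1 - β * a ≠ 0 := by linarith
      field_simp
    have eB : B ^ 2 * (b⁻¹ - β) = β * B := by
      rw [hBdef]
      have : 1 - β * b ≠ 0 := by linarith
      field_simp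
    have eC : (-T) ^ 2 * (c⁻¹ - β) = -(T ^ 2 * ((β * c - 1) / c)) := by
      field_simp
      ring
    change 0 ≤ A ^ 2 * (a⁻¹ - β) + ((-T) ^ 2 * (c⁻¹ - β) + _) at hsoc
    rw [eA, eB, eC] at hsoc
    have h1 : T * (T * ((β * c - 1) / c)) ≤ T * β := by rw [hT] at *; linarith
    have h2 := le_of_mul_le_mul_left h1 hTpos
    rw [le_div_iff₀ (by linarith)]
    rw [mul_div_assoc', div_le_iff₀ hc] at h2
    linarith

/-- The asymmetric minima at given parameters form one orbit under permutations. -/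
theorem asymmetric_minima_eq_lastPerms {n : ℕ} [NeZero n] (hn : 3 ≤ n) {β h : ℝ} (hh : h < 0)
    {x : Fin (n + 1) → ℝ} (hx : x ∈ globalMinima (n + 1) β h)
    (hasym : ¬ ∀ j k, j ≠ 0 → k ≠ 0 → x j = x k) :
    ∃ a b c, a < b ∧ b < c ∧
      {y | y ∈ globalMinima (n + 1) β h ∧ ¬ ∀ j k, j ≠ 0 → k ≠ 0 → y j = y k} =
        lastPerms (n + 1) (blockVec (n + 1) a b c) := by
  have hn3 : (3 : ℝ) ≤ n := by exact_mod_cast hn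
  obtain ⟨k, hk, a, b, c, ha, hab, hbc, hβ, hb1, hc1, rfl, hsum, hl1, hl2, hM⟩ :=
    asymmetric_structure hh hx hasym
  have hscale : ∀ t s : ℝ, 0 < t → 0 < s → ∀ d, Real.log t - β * t = Real.log s - β * s + d →
      Real.log (β * t) - β * t = Real.log (β * s) - β * s + d := by
    intro t s ht hs d h
    rw [Real.log_mul hβ.ne' ht.ne', Real.log_mul hβ.ne' hs.ne']
    linarith
  have hb := ha.trans hab
  have hc := hb.trans hbc
  refine ⟨a, b, c, hab, hbc, Set.Subset.antisymm ?_ ?_⟩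
  · rintro y ⟨hy, hyasym⟩
    obtain ⟨k', hk', a', b', c', ha', hab', hbc', -, hb1', hc1', rfl, hsum', hl1', hl2', hM'⟩ :=
      asymmetric_structure hh hy hyasym
    have hb' := ha'.trans hab'
    have hc' := hb'.trans hbc'
    obtain ⟨e1, e2, e3⟩ := asymmetric_solution_unique (N := (n : ℝ) - 1) (h := h) (by linarith) hh
      (by positivity : 0 < β * a) (mul_lt_mul_of_pos_left hab hβ) hb1 hc1
      (by simpa using hscale b c hb hc 0 (by simpa using hl1)) (hscale a b ha hb h hl2) hM
      (by positivity : 0 < β * a') (mul_lt_mul_of_pos_left hab' hβ) hb1' hc1'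
      (by simpa using hscale b' c' hb' hc' 0 (by simpa using hl1')) (hscale a' b' ha' hb' h hl2')
      hM' (by
        have : β * (a + ((n : ℝ) - 1) * b + c) = β * (a' + ((n : ℝ) - 1) * b' + c') := by
          rw [hsum, hsum']
        linarith)
    rw [mul_right_inj' hβ.ne'] at e1 e2 e3
    subst e1 e2 e3
    rw [lastPerms_blockVec]
    exact ⟨k', hk', rfl⟩
  · rw [lastPerms_blockVec]
    rintro _ ⟨k', hk', rfl⟩
    have hk' : k' ≠ 0 := hk'
    have hmem := comp_perm_mem_globalMinima hx (σ := Equiv.swap k k')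
      (Equiv.swap_apply_of_ne_of_ne hk.symm hk'.symm)
    have heq : (fun l => if l = 0 then a else if l = k then c else b) ∘ Equiv.swap k k' =
        fun l => if l = 0 then a else if l = k' then c else b := by
      funext l
      have e1 : Equiv.swap k k' l = 0 ↔ l = 0 := by
        rw [Equiv.swap_apply_eq_iff, Equiv.swap_apply_of_ne_of_ne hk.symm hk'.symm]
      have e2 : Equiv.swap k k' l = k ↔ l = k' := by
        rw [Equiv.swap_apply_eq_iff, Equiv.swap_apply_left]
      simp only [Function.comp_apply, e1, e2]
    rw [heq] at hmem
    refine ⟨hmem, fun hcon => ?_⟩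
    -- As `n ≥ 3`, some tail coordinate other than `k'` carries the value `b`.
    obtain ⟨l, hl⟩ : ∃ l : Fin (n + 1), l ∉ ({0, k'} : Finset (Fin (n + 1))) := by
      refine Finset.exists_mem_notMem_of_card_lt_card (s := {0, k'}) (t := Finset.univ) ?_
        |>.imp fun _ h => h.2
      refine (Finset.card_le_two).trans_lt ?_
      simp; omega
    simp only [Finset.mem_insert, Finset.mem_singleton, not_or] at hl
    have := hcon l k' hl.1 hk'
    simp only [hl.1, hl.2, hk', if_false, if_true] at this
    exact hbc.ne this

/-! ### The two phases and the transition line. -/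

/-- Parameters `(β, h)` with a global minimum that is symmetric in the zero-field coordinates and
does not favour the first one. -/
def symPhase (n : ℕ) : Set (ℝ × ℝ) :=
  {p | ∃ x ∈ globalMinima (n + 1) p.1 p.2,
    (∀ k, x 0 ≤ x k) ∧ ∀ j k, j ≠ 0 → k ≠ 0 → x j = x k}

/-- Parameters `(β, h)` with a global minimum that is quantitatively asymmetric in the zero-field
coordinates. -/
def asymPhase (n : ℕ) : Set (ℝ × ℝ) :=
  {p | ∃ x ∈ globalMinima (n + 1) p.1 p.2,
    ∃ j k, j ≠ 0 ∧ k ≠ 0 ∧ 1 / 2 ≤ p.1 * (x k - x j)}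

/-- The transition line between the two phases. -/
noncomputable def transitionCoupling (n : ℕ) (h : ℝ) : ℝ := sSup {β | (β, h) ∈ symPhase n}

theorem isClosed_symPhase (n : ℕ) : IsClosed (symPhase n) := by
  refine isClosed_setOf_exists_globalMinima (n + 1)
    (C := {p | (∀ k, p.2 0 ≤ p.2 k) ∧ ∀ j k, j ≠ 0 → k ≠ 0 → p.2 j = p.2 k}) ?_
  simp only [Set.ofPred_and, Set.ofPred_forall]
  refine (isClosed_iInter fun k => isClosed_le (by fun_prop) (by fun_prop)).inter ?_
  exact isClosed_iInter fun j => isClosed_iInter fun k => isClosed_iInter fun _ =>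
    isClosed_iInter fun _ => isClosed_eq (by fun_prop) (by fun_prop)

theorem isClosed_asymPhase (n : ℕ) : IsClosed (asymPhase n) := by
  refine isClosed_setOf_exists_globalMinima (n + 1)
    (C := {p | ∃ j k, j ≠ 0 ∧ k ≠ 0 ∧ 1 / 2 ≤ p.1.1 * (p.2 k - p.2 j)}) ?_
  simp only [Set.ofPred_exists, Set.ofPred_and]
  exact isClosed_iUnion_of_finite fun j => isClosed_iUnion_of_finite fun k =>
    isClosed_const.inter (isClosed_const.inter (isClosed_le (by fun_prop) (by fun_prop)))

theorem mem_symPhase_of_symmetric {n : ℕ} {β h : ℝ} (hh : h < 0) {x : Fin (n + 1) → ℝ}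
    (hx : x ∈ globalMinima (n + 1) β h) (hsym : ∀ j k, j ≠ 0 → k ≠ 0 → x j = x k) :
    (β, h) ∈ symPhase n :=
  ⟨x, hx, globalMinima_zero_le hh hx, hsym⟩

theorem exists_asymmetric_of_mem_asymPhase {n : ℕ} {β h : ℝ} (hp : (β, h) ∈ asymPhase n) :
    ∃ x ∈ globalMinima (n + 1) β h, ¬ ∀ j k, j ≠ 0 → k ≠ 0 → x j = x k := by
  obtain ⟨x, hx, j, k, hj, hk, hgap⟩ := hp
  refine ⟨x, hx, fun hsym => ?_⟩
  simp only [hsym j k hj hk, sub_self, mul_zero] at hgap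
  norm_num at hgap

section
variable {n : ℕ} [NeZero n]

/-- The second order condition forces `β c ≥ 3/2` while `β b < 1`. This uniform gap prevents
asymmetric minima from merging into symmetric ones in a limit. -/
theorem mem_asymPhase_of_asymmetric (hn : 3 ≤ n) {β h : ℝ} (hh : h < 0) {x : Fin (n + 1) → ℝ}
    (hx : x ∈ globalMinima (n + 1) β h) (hasym : ¬ ∀ j k, j ≠ 0 → k ≠ 0 → x j = x k) :
    (β, h) ∈ asymPhase n := by
  have hn3 : (3 : ℝ) ≤ n := by exact_mod_cast hn
  obtain ⟨k, hk, a, b, c, ha, hab, hbc, hβ, hb1, hc1, hxe, hsum, hl1, hl2, hM⟩ :=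
    asymmetric_structure hh hx hasym
  have hb := ha.trans hab
  have hc := hb.trans hbc
  obtain ⟨l, hl0, hlk⟩ : ∃ l : Fin (n + 1), l ≠ 0 ∧ l ≠ k := by
    by_contra! hcon
    have : ∀ j, j ≠ 0 → x j = x k := fun j hj => by rw [hcon j hj]
    exact hasym fun i j hi hj => (this i hi).trans (this j hj).symm
  refine ⟨x, hx, l, k, hl0, hk, ?_⟩
  have h2 := inv_sub_one_le_two (N := (n : ℝ) - 1) (by linarith) (mul_pos hβ hb) hb1 hc1
    (mul_pos hβ ha) ((mul_lt_mul_of_pos_left hab hβ).trans hb1)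
    (by rw [Real.log_mul hβ.ne' hb.ne', Real.log_mul hβ.ne' hc.ne']; linarith) hM
  rw [inv_le_comm₀ (by linarith) (by norm_num)] at h2
  rw [hxe]
  simp only [hl0, hlk, hk, if_false, if_true]
  linarith

theorem mem_symPhase_or_mem_asymPhase (hn : 3 ≤ n) (β : ℝ) {h : ℝ} (hh : h < 0) :
    (β, h) ∈ symPhase n ∨ (β, h) ∈ asymPhase n := by
  obtain ⟨x, hx⟩ := globalMinima_nonempty (n + 1) β h
  by_cases hsym : ∀ j k, j ≠ 0 → k ≠ 0 → x j = x k
  · exact Or.inl (mem_symPhase_of_symmetric hh hx hsym)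
  · exact Or.inr (mem_asymPhase_of_asymmetric hn hh hx hsym)

theorem notMem_symPhase_of_lt (hn : 3 ≤ n) {β β' h : ℝ} (hh : h < 0) (hβ : β < β')
    (hp : (β, h) ∈ asymPhase n) : (β', h) ∉ symPhase n := by
  rintro ⟨y, hy, -, hsym⟩
  obtain ⟨x, hx, hasym⟩ := exists_asymmetric_of_mem_asymPhase hp
  exact not_symmetric_of_asymmetric_of_lt hn hh hβ hx hy hasym hsym

/-- An asymmetric minimum has a coordinate with `β c > 1`, which is impossible at `β = 1`. -/
theorem one_mem_symPhase (hn : 3 ≤ n) {h : ℝ} (hh : h < 0) : ((1 : ℝ), h) ∈ symPhase n := by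
  refine (mem_symPhase_or_mem_asymPhase hn 1 hh).resolve_right fun hp => ?_
  obtain ⟨x, hx, hasym⟩ := exists_asymmetric_of_mem_asymPhase hp
  obtain ⟨k, hk, a, b, c, ha, hab, hbc, hβ, hb1, hc1, hxe, hsum, -⟩ :=
    asymmetric_structure hh hx hasym
  have hn3 : (3 : ℝ) ≤ n := by exact_mod_cast hn
  nlinarith

/-- From `x 0 < x 1 ≤ 1 - x 0` the tail has mass above `1/2`, while `β (1 - x 0) ≤ betaMF n`. -/
theorem le_two_mul_betaMF_of_mem_symPhase (hn : 3 ≤ n) {β h : ℝ} (hh : h < 0)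
    (hp : (β, h) ∈ symPhase n) : β ≤ 2 * betaMF n := by
  obtain ⟨x, hx, -, hsym⟩ := hp
  have h1 := mul_le_betaMF_of_symmetric hn hx hsym
  have hB := betaMF_pos hn
  have hlt := globalMinima_zero_lt hh hx (Fin.succ_ne_zero 0)
  have hle : x (Fin.succ 0) ≤ 1 - x 0 := by
    have := hx.1.2
    rw [Fin.sum_univ_succ] at this
    rw [← this, add_sub_cancel_left]
    exact Finset.single_le_sum (f := fun k : Fin n => x k.succ) (fun k _ => hx.1.1 _)
      (Finset.mem_univ 0)
  by_contra hcon
  push Not at hcon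
  nlinarith

theorem bddAbove_symPhase (hn : 3 ≤ n) {h : ℝ} (hh : h < 0) :
    BddAbove {β | (β, h) ∈ symPhase n} :=
  ⟨2 * betaMF n, fun _ hβ => le_two_mul_betaMF_of_mem_symPhase hn hh hβ⟩

theorem transitionCoupling_mem_symPhase (hn : 3 ≤ n) {h : ℝ} (hh : h < 0) :
    (transitionCoupling n h, h) ∈ symPhase n := by
  have hcl : IsClosed {β : ℝ | (β, h) ∈ symPhase n} :=
    (isClosed_symPhase n).preimage (by fun_prop : Continuous fun β : ℝ => (β, h))
  exact hcl.csSup_mem ⟨1, one_mem_symPhase hn hh⟩ (bddAbove_symPhase hn hh)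

theorem notMem_symPhase_of_transitionCoupling_lt (hn : 3 ≤ n) {β h : ℝ} (hh : h < 0)
    (hβ : transitionCoupling n h < β) : (β, h) ∉ symPhase n := fun hp =>
  (le_csSup (bddAbove_symPhase hn hh) hp).not_gt hβ

/-- Every larger coupling lies in the asymmetric phase, which is closed. -/
theorem transitionCoupling_mem_asymPhase (hn : 3 ≤ n) {h : ℝ} (hh : h < 0) :
    (transitionCoupling n h, h) ∈ asymPhase n := by
  have hcl : IsClosed {β : ℝ | (β, h) ∈ asymPhase n} :=
    (isClosed_asymPhase n).preimage (by fun_prop : Continuous fun β : ℝ => (β, h))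
  have hsub : Set.Ioi (transitionCoupling n h) ⊆ {β : ℝ | (β, h) ∈ asymPhase n} := fun β hβ =>
    (mem_symPhase_or_mem_asymPhase hn β hh).resolve_left
      (notMem_symPhase_of_transitionCoupling_lt hn hh hβ)
  have := closure_minimal hsub hcl
  rw [closure_Ioi] at this
  exact this Set.self_mem_Ici

theorem lt_transitionCoupling_iff (hn : 3 ≤ n) {β h : ℝ} (hh : h < 0) :
    β < transitionCoupling n h ↔ (β, h) ∉ asymPhase n := by
  constructor
  · intro hβ hp
    exact notMem_symPhase_of_lt hn hh hβ hp (transitionCoupling_mem_symPhase hn hh)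
  · intro hp
    by_contra hcon
    rcases (not_lt.mp hcon).eq_or_lt with heq | hlt
    · exact hp (heq ▸ transitionCoupling_mem_asymPhase hn hh)
    · exact (mem_symPhase_or_mem_asymPhase hn β hh).elim
        (notMem_symPhase_of_transitionCoupling_lt hn hh hlt) hp

theorem transitionCoupling_lt_iff (hn : 3 ≤ n) {β h : ℝ} (hh : h < 0) :
    transitionCoupling n h < β ↔ (β, h) ∉ symPhase n := by
  refine ⟨notMem_symPhase_of_transitionCoupling_lt hn hh, fun hp => ?_⟩
  by_contra hcon
  rcases (not_lt.mp hcon).eq_or_lt with heq | hlt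
  · exact hp (heq ▸ transitionCoupling_mem_symPhase hn hh)
  · exact (mem_symPhase_or_mem_asymPhase hn β hh).elim hp
      ((lt_transitionCoupling_iff hn hh).mp hlt)

theorem one_le_transitionCoupling (hn : 3 ≤ n) {h : ℝ} (hh : h < 0) :
    1 ≤ transitionCoupling n h :=
  le_csSup (bddAbove_symPhase hn hh) (one_mem_symPhase hn hh)

/-- If the first coordinates agreed, `y` would be minimal for both fields, and the first order
condition would give `h = h'`. -/
theorem zero_lt_zero_of_globalMinima {β h h' : ℝ} (hh : h < h')
    {x y : Fin (n + 1) → ℝ} (hx : x ∈ globalMinima (n + 1) β h)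
    (hy : y ∈ globalMinima (n + 1) β h') : x 0 < y 0 := by
  refine lt_of_le_of_ne (zero_le_zero_of_globalMinima hh hx hy) fun heq => ?_
  have hy' : y ∈ globalMinima (n + 1) β h := by
    refine ⟨hy.1, fun z hz => le_trans ?_ (hx.2 z hz)⟩
    have := hy.2 x hx.1
    simp only [pottsFreeEnergy] at this ⊢
    rw [heq] at this ⊢
    linarith
  have h1 := globalMinima_log_eq_field hy (Fin.succ_ne_zero 0)
  have h2 := globalMinima_log_eq_field hy' (Fin.succ_ne_zero 0)
  linarith

/-- An asymmetric `y` for the larger field at the same coupling would satisfy `β (1 - x 0) ≤ betaMF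
n ≤ β (1 - y 0)`, against `x 0 < y 0`. -/
theorem strictMonoOn_transitionCoupling (hn : 3 ≤ n) :
    StrictMonoOn (transitionCoupling n) (Set.Iio 0) := by
  intro h hh h' hh' hlt
  rw [lt_transitionCoupling_iff hn hh']
  intro hp
  obtain ⟨y, hy, hasym⟩ := exists_asymmetric_of_mem_asymPhase hp
  obtain ⟨x, hx, -, hsym⟩ := transitionCoupling_mem_symPhase hn hh
  have h1 := mul_le_betaMF_of_symmetric hn hx hsym
  have h2 := betaMF_le_mul_of_asymmetric hn hy hasym
  have h3 := zero_lt_zero_of_globalMinima hlt hx hy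
  have h4 := one_le_transitionCoupling hn hh
  simp only at h1
  nlinarith

/-! ### Continuity and limits of the transition line. -/

/-- If the phases do not extend across `B` at field `h₀`, the transition line tends to `B`. -/
theorem tendsto_transitionCoupling_nhdsWithin (hn : 3 ≤ n) {h₀ B : ℝ}
    (hlt : ∀ β < B, (β, h₀) ∉ asymPhase n) (hgt : ∀ β > B, (β, h₀) ∉ symPhase n) :
    Tendsto (transitionCoupling n) (𝓝[Set.Iio 0] h₀) (𝓝 B) := by
  have hc : ∀ β : ℝ, Continuous fun h : ℝ => (β, h) := fun β => by fun_prop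
  refine tendsto_order.2 ⟨fun β hβ => ?_, fun β hβ => ?_⟩
  · have hev := (((isClosed_asymPhase n).preimage (hc β)).isOpen_compl.mem_nhds (hlt β hβ))
    filter_upwards [self_mem_nhdsWithin, nhdsWithin_le_nhds hev] with h hh hp
    exact (lt_transitionCoupling_iff hn hh).mpr hp
  · have hev := (((isClosed_symPhase n).preimage (hc β)).isOpen_compl.mem_nhds (hgt β hβ))
    filter_upwards [self_mem_nhdsWithin, nhdsWithin_le_nhds hev] with h hh hp
    exact (transitionCoupling_lt_iff hn hh).mpr hp

theorem continuousOn_transitionCoupling (hn : 3 ≤ n) :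
    ContinuousOn (transitionCoupling n) (Set.Iio 0) := fun _ hh =>
  tendsto_transitionCoupling_nhdsWithin hn
    (fun _ hβ => (lt_transitionCoupling_iff hn hh).mp hβ)
    (fun _ hβ => (transitionCoupling_lt_iff hn hh).mp hβ)

/-- At zero field the phases are separated by `betaMF (n + 1)`. The clause `x 0 ≤ x k` in `symPhase`
is essential here: it rules out zero-field minima whose large coordinate is the first, as these have
constant tails. -/
theorem tendsto_transitionCoupling_zero (hn : 3 ≤ n) :
    Tendsto (transitionCoupling n) (𝓝[<] 0) (𝓝 (betaMF (n + 1))) := by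
  refine tendsto_transitionCoupling_nhdsWithin hn (fun β hβ hp => ?_) (fun β hβ hp => ?_)
  · obtain ⟨x, hx, hasym⟩ := exists_asymmetric_of_mem_asymPhase hp
    have hu := eq_uniform_of_lt_betaMF (by omega) hβ hx
    exact hasym fun j k _ _ => (hu j).trans (hu k).symm
  · obtain ⟨x, hx, hle, hsym⟩ := hp
    rcases globalMinima_structure hx (F := Set.univ) (fun _ _ => Or.inr rfl) with hall | hone
    · refine uniform_notMem_globalMinima (by omega) hβ ?_
      convert hx using 1
      funext k
      have hsum := hx.1.2
      simp only [hall _ trivial k trivial, Finset.sum_const, Finset.card_univ, Fintype.card_fin,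
        nsmul_eq_mul] at hsum
      exact inv_eq_of_mul_eq_one_right hsum
    · obtain ⟨k, -, j, -, hlt, -, -, hl⟩ := hone
      have hk : k ≠ 0 := by
        rintro rfl
        exact (hle j).not_gt hlt
      obtain ⟨l, hl0, hlk⟩ : ∃ l : Fin (n + 1), l ≠ 0 ∧ l ≠ k := by
        obtain ⟨l, -, hl⟩ := Finset.exists_mem_notMem_of_card_lt_card (s := {0, k})
          (t := (Finset.univ : Finset (Fin (n + 1))))
          (Finset.card_le_two.trans_lt (by simp; omega))
        simp only [Finset.mem_insert, Finset.mem_singleton, not_or] at hl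
        exact ⟨l, hl⟩
      have := hl l trivial hlk
      rw [hsym l k hl0 hk] at this
      exact hlt.ne' this

theorem betaMF_le_transitionCoupling (hn : 3 ≤ n) {h : ℝ} (hh : h < 0) :
    betaMF n ≤ transitionCoupling n h := by
  obtain ⟨x, hx, hasym⟩ :=
    exists_asymmetric_of_mem_asymPhase (transitionCoupling_mem_asymPhase hn hh)
  have h1 := betaMF_le_mul_of_asymmetric hn hx hasym
  have h2 := one_le_transitionCoupling hn hh
  have h3 := hx.1.1 0
  nlinarith

/-- For a symmetric minimum the first order condition gives `log (x 0) ≤ h`, hence `x 0 ≤ exp h` in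
`β (1 - x 0) ≤ betaMF n`. -/
theorem transitionCoupling_mul_le_betaMF (hn : 3 ≤ n) {h : ℝ} (hh : h < 0) :
    transitionCoupling n h * (1 - Real.exp h) ≤ betaMF n := by
  obtain ⟨x, hx, -, hsym⟩ := transitionCoupling_mem_symPhase hn hh
  simp only at hx
  have h1 := mul_le_betaMF_of_symmetric hn hx hsym
  have h2 := one_le_transitionCoupling hn hh
  have hk : (Fin.succ 0 : Fin (n + 1)) ≠ 0 := Fin.succ_ne_zero 0
  have h3 := globalMinima_log_eq_field hx hk
  have h4 := globalMinima_zero_lt hh hx hk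
  have hw : x (Fin.succ 0) ≤ 1 :=
    (Finset.single_le_sum (fun k _ => hx.1.1 k) (Finset.mem_univ _)).trans_eq hx.1.2
  have h5 := Real.log_nonpos (hx.1.1 (Fin.succ 0)) hw
  have h6 : Real.log (x 0) ≤ h := by nlinarith
  have h7 : x 0 ≤ Real.exp h := (Real.log_le_iff_le_exp (globalMinima_pos hx 0)).mp h6
  nlinarith

theorem tendsto_transitionCoupling_atBot (hn : 3 ≤ n) :
    Tendsto (transitionCoupling n) atBot (𝓝 (betaMF n)) := by
  have hlim : Tendsto (fun h => betaMF n / (1 - Real.exp h)) atBot (𝓝 (betaMF n)) := by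
    have : Tendsto (fun h => betaMF n / (1 - Real.exp h)) atBot (𝓝 (betaMF n / (1 - 0))) :=
      tendsto_const_nhds.div (tendsto_const_nhds.sub Real.tendsto_exp_atBot) (by norm_num)
    simpa using this
  refine tendsto_of_tendsto_of_tendsto_of_le_of_le' tendsto_const_nhds hlim ?_ ?_
  · filter_upwards [Iio_mem_atBot 0] with h hh using betaMF_le_transitionCoupling hn hh
  · filter_upwards [Iio_mem_atBot 0] with h hh
    rw [le_div_iff₀ (sub_pos.mpr (by simpa using hh))]
    exact transitionCoupling_mul_le_betaMF hn hh

/-! ### The minima in each phase. -/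

theorem symmetric_minima_unique (hn : 1 ≤ n) {β h : ℝ} (hh : h < 0) {x y : Fin (n + 1) → ℝ}
    (hx : x ∈ globalMinima (n + 1) β h) (hxs : ∀ j k, j ≠ 0 → k ≠ 0 → x j = x k)
    (hy : y ∈ globalMinima (n + 1) β h) (hys : ∀ j k, j ≠ 0 → k ≠ 0 → y j = y k) : x = y := by
  have hn1 : (1 : ℝ) ≤ n := by exact_mod_cast hn
  obtain ⟨m, rfl, hm, hms⟩ := exists_eq_symVec_of_symmetric hh hx hxs
  obtain ⟨m', rfl, hm', hms'⟩ := exists_eq_symVec_of_symmetric hh hy hys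
  have := (existsUnique_symEquation (by omega) hh).unique ⟨hm, hms⟩ ⟨hm', hms'⟩
  have hne : ((n + 1 : ℕ) : ℝ) / (((n + 1 : ℕ) : ℝ) - 1) ≠ 0 := by
    push_cast
    rw [add_sub_cancel_right]
    positivity
  rw [mul_right_injective₀ hne this]

/-- For the converse, some symmetric minimum exists and solves the same equation; uniqueness of the
solution identifies it with `symVec (n + 1) m`. -/
theorem mem_globalMinima_symVec_iff (hn : 1 ≤ n) {β h m : ℝ} (hh : h < 0)
    (hp : (β, h) ∈ symPhase n)
    (hm : ((n + 1 : ℕ) : ℝ) / (((n + 1 : ℕ) : ℝ) - 1) * m ∈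
      Set.Icc 0 (1 / (((n + 1 : ℕ) : ℝ) - 1))) :
    symVec (n + 1) m ∈ globalMinima (n + 1) β h ↔
      SymEquation (n + 1) β h (((n + 1 : ℕ) : ℝ) / (((n + 1 : ℕ) : ℝ) - 1) * m) := by
  have hn1 : (1 : ℝ) ≤ n := by exact_mod_cast hn
  constructor
  · intro hmem
    obtain ⟨m', heq, -, hs⟩ := exists_eq_symVec_of_symmetric hh hmem (symVec_symmetric _ m)
    rwa [symVec_injective _ heq]
  · intro hs
    obtain ⟨x, hx, -, hsym⟩ := hp
    obtain ⟨m', rfl, hm', hs'⟩ := exists_eq_symVec_of_symmetric hh hx hsym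
    have := (existsUnique_symEquation (by omega) hh).unique ⟨hm, hs⟩ ⟨hm', hs'⟩
    have hne : ((n + 1 : ℕ) : ℝ) / (((n + 1 : ℕ) : ℝ) - 1) ≠ 0 := by
      push_cast
      rw [add_sub_cancel_right]
      positivity
    rwa [mul_right_injective₀ hne this]

theorem exists_mem_lastPerms_of_mem_globalMinima {β h : ℝ} (hh : h < 0) {x : Fin (n + 1) → ℝ}
    (hx : x ∈ globalMinima (n + 1) β h) :
    ∃ a b c : ℝ, a < b ∧ b ≤ c ∧ x ∈ lastPerms (n + 1) (blockVec (n + 1) a b c) := by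
  by_cases hsym : ∀ j k, j ≠ 0 → k ≠ 0 → x j = x k
  · have hk : (Fin.succ 0 : Fin (n + 1)) ≠ 0 := Fin.succ_ne_zero 0
    refine ⟨x 0, x (Fin.succ 0), x (Fin.succ 0), globalMinima_zero_lt hh hx hk, le_rfl, ?_⟩
    rw [lastPerms_blockVec]
    refine ⟨Fin.succ 0, hk, ?_⟩
    funext l
    rcases eq_or_ne l 0 with rfl | hl
    · simp
    · simp [hl, hsym l _ hl hk]
  · obtain ⟨k, hk, a, b, c, -, hab, hbc, -, -, -, rfl, -⟩ := asymmetric_structure hh hx hsym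
    refine ⟨a, b, c, hab, hbc.le, ?_⟩
    rw [lastPerms_blockVec]
    exact ⟨k, hk, rfl⟩

end

theorem theorem2p2 (q : ℕ) [NeZero q] (hq : 4 ≤ q) :
    -- the form of all global minima
    (∀ β h : ℝ, h < 0 → ∀ x ∈ globalMinima q β h,
      ∃ a b c : ℝ, a < b ∧ b ≤ c ∧ x ∈ lastPerms q (blockVec q a b c)) ∧
    ∃ βm : ℝ → ℝ,
      (∀ h < 0, 0 < βm h) ∧
      -- below the transition: the symmetric minimum
      (∀ h < 0, ∀ β < βm h,
        (∃ x : Fin q → ℝ, globalMinima q β h = {x} ∧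
          ∀ j k : Fin q, j ≠ 0 → k ≠ 0 → x j = x k) ∧
        (∀ m : ℝ, (q : ℝ) / ((q : ℝ) - 1) * m ∈ Set.Icc 0 (1 / ((q : ℝ) - 1)) →
          (symVec q m ∈ globalMinima q β h ↔
            SymEquation q β h ((q : ℝ) / ((q : ℝ) - 1) * m)))) ∧
      (∀ h < 0, ∀ β : ℝ,
        ∃! θ : ℝ, θ ∈ Set.Icc 0 (1 / ((q : ℝ) - 1)) ∧ SymEquation q β h θ) ∧
      -- above the transition: the asymmetric minima
      (∀ h < 0, ∀ β > βm h,
        (globalMinima q β h).ncard = q - 1 ∧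
        ∃ a b c : ℝ, a < b ∧ b < c ∧
          globalMinima q β h = lastPerms q (blockVec q a b c)) ∧
      -- coexistence at the transition
      (∀ h < 0,
        (globalMinima q (βm h) h).ncard = q ∧
        ∃ m a b c : ℝ, a < b ∧ b < c ∧
          (q : ℝ) / ((q : ℝ) - 1) * m ∈ Set.Icc 0 (1 / ((q : ℝ) - 1)) ∧
          SymEquation q (βm h) h ((q : ℝ) / ((q : ℝ) - 1) * m) ∧
          globalMinima q (βm h) h = {symVec q m} ∪ lastPerms q (blockVec q a b c)) ∧
      -- monotonicity, continuity and limits of the transition line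
      StrictMonoOn βm (Set.Iio 0) ∧
      ContinuousOn βm (Set.Iio 0) ∧
      Tendsto βm atBot (𝓝 (betaMF (q - 1))) ∧
      Tendsto βm (𝓝[<] 0) (𝓝 (betaMF q)) := by
  obtain ⟨n, rfl⟩ : ∃ n, q = n + 1 := ⟨q - 1, by omega⟩
  have hn : 3 ≤ n := by omega
  have : NeZero n := ⟨by omega⟩
  refine ⟨fun β h hh x hx => exists_mem_lastPerms_of_mem_globalMinima hh hx,
    transitionCoupling n, fun h hh => zero_lt_one.trans_le (one_le_transitionCoupling hn hh),
    fun h hh β hβ => ?_, fun h hh β => existsUnique_symEquation (by omega) hh,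
    fun h hh β hβ => ?_, fun h hh => ?_, strictMonoOn_transitionCoupling hn,
    continuousOn_transitionCoupling hn, tendsto_transitionCoupling_atBot hn,
    tendsto_transitionCoupling_zero hn⟩
  · have hA := (lt_transitionCoupling_iff hn hh).mp hβ
    have hS := (mem_symPhase_or_mem_asymPhase hn β hh).resolve_right hA
    refine ⟨?_, fun m hm => mem_globalMinima_symVec_iff (by omega) hh hS hm⟩
    have hall : ∀ y ∈ globalMinima (n + 1) β h, ∀ j k, j ≠ 0 → k ≠ 0 → y j = y k := by
      intro y hy
      by_contra hcon
      exact hA (mem_asymPhase_of_asymmetric hn hh hy hcon)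
    obtain ⟨x, hx, -, hsym⟩ := hS
    exact ⟨x, Set.eq_singleton_iff_unique_mem.mpr ⟨hx, fun y hy =>
      symmetric_minima_unique (by omega) hh hy (hall y hy) hx hsym⟩, hsym⟩
  · have hS := (transitionCoupling_lt_iff hn hh).mp hβ
    have hA := (mem_symPhase_or_mem_asymPhase hn β hh).resolve_left hS
    obtain ⟨x, hx, hasym⟩ := exists_asymmetric_of_mem_asymPhase hA
    obtain ⟨a, b, c, hab, hbc, heq⟩ := asymmetric_minima_eq_lastPerms hn hh hx hasym
    have hgm : globalMinima (n + 1) β h = lastPerms (n + 1) (blockVec (n + 1) a b c) := by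
      rw [← heq]
      ext y
      exact ⟨fun hy => ⟨hy, fun hys => hS (mem_symPhase_of_symmetric hh hy hys)⟩, fun hy => hy.1⟩
    exact ⟨by rw [hgm, ncard_lastPerms_blockVec a hbc.ne, Nat.add_sub_cancel],
      a, b, c, hab, hbc, hgm⟩
  · obtain ⟨x, hx, hasym⟩ :=
      exists_asymmetric_of_mem_asymPhase (transitionCoupling_mem_asymPhase hn hh)
    obtain ⟨y, hy, -, hys⟩ := transitionCoupling_mem_symPhase hn hh
    obtain ⟨a, b, c, hab, hbc, heq⟩ := asymmetric_minima_eq_lastPerms hn hh hx hasym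
    obtain ⟨m, rfl, hm, hms⟩ := exists_eq_symVec_of_symmetric hh hy hys
    have hgm : globalMinima (n + 1) (transitionCoupling n h) h =
        {symVec (n + 1) m} ∪ lastPerms (n + 1) (blockVec (n + 1) a b c) := by
      rw [← heq]
      ext z
      constructor
      · intro hz
        by_cases hzs : ∀ j k, j ≠ 0 → k ≠ 0 → z j = z k
        · exact Or.inl (symmetric_minima_unique (by omega) hh hz hzs hy hys)
        · exact Or.inr ⟨hz, hzs⟩
      · rintro (rfl | hz)
        · exact hy
        · exact hz.1
    refine ⟨?_, m, a, b, c, hab, hbc, hm, hms, hgm⟩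
    have hcard := ncard_lastPerms_blockVec (n := n) a hbc.ne
    have hnot : symVec (n + 1) m ∉ lastPerms (n + 1) (blockVec (n + 1) a b c) := by
      rw [← heq]
      exact fun hmem => hmem.2 hys
    rw [hgm, Set.singleton_union,
      Set.ncard_insert_of_notMem hnot (Set.finite_of_ncard_pos (by omega)), hcard]
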